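/- A *Feynman graph of the quartic model* is a finite graph (multiple edges allowed) with edges coloured by $0,1,2,3$ in which every node is incident to exactly one edge of each of the colours $1,2,3$ and to at most one edge of colour $0$ (the *lines*), and in which every connected component left after deleting the lines (a *bubble*) has four nodes and is of one of the following types: the *tetrahedron*, that is, the properly $3$-edge-coloured complete graph $K_4$; or the *pillow of colour $\ell$*, $\ell\in\{1,2,3\}$, which consists of two double edges, each with the two colours different from $\ell$, connected to each other by two edges of colour $\ell$. A node without a line carries an *external leg*. A *vacuum graph* is a non-empty connected graph of this kind without external legs. A *two-point graph* has exactly two external legs; its *closure* joins them into one line. The *degree* of a vacuum graph $\mathcal G$ with $L$ lines, $n_1$ tetrahedra, $n_2$ pillows and $F$ faces (a face being a cycle that alternates between lines and edges of one colour $\ell\in\{1,2,3\}$) is $$\omega(\mathcal G)=3+\tfrac32 L-\tfrac32 n_1-n_2-F .$$ A vacuum graph is of *leading order* if $\omega=0$; a two-point graph is of leading order if its closure is a vacuum graph of leading order. The *elementary melon of type I* is the two-point graph formed by two tetrahedra with nodes $t_0,\dots,t_3$ and $s_0,\dots,s_3$, labelled so that $t_it_j$ and $s_is_j$ have the same colour,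 with lines $t_is_i$ for $i=1,2,3$ and external legs at $t_0$ and $s_0$. The *elementary melon of type II* (one for each colour $\ell$) is formed by a pillow of colour $\ell$, with one line parallel to one of its double edges and external legs at the two ends of the other double edge. A *melonic insertion* of type I or II cuts a line of a graph and joins the two resulting half-lines to the two legs of an elementary melon of that type. The vacuum *melonic graphs* are the graphs generated, up to colour-preserving isomorphism, by melonic insertions of types I and II from the base graphs that are the closures of the elementary melons (two tetrahedra joined by four lines; a pillow of colour $\ell$ with two lines parallel to its two double edges, for each $\ell$). **Proposition.** (a) The vacuum graphs of the quartic model of degree $0$ are exactly the vacuum melonic graphs. (b) Every two-point leading order graph contains, as a two-point subgraph, an elementary melon of type I or of type II. -/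

import Mathlib

universe u v

/-- A four-coloured graph with node set `V`, possibly with external legs. `edge ℓ` sends a node to
the other end of its edge of colour `ℓ` (the three colours are the elements of `Fin 3`). `line` is
the remaining colour (colour zero, the propagator lines): it sends a node to the other end of its
propagator line; a fixed point of `line` is a node which carries an external leg.
Multiple edges (of distinct colours) are allowed, loops are not. -/
structure TensorGraph (V : Type u) where
  edge : Fin 3 → V → V
  edge_edge : ∀ ℓ x, edge ℓ (edge ℓ x) = x
  edge_ne : ∀ ℓ x, edge ℓ x ≠ x
  line : V → V
  line_line : ∀ x, line (line x) = x

/-- The four nodes of a quartic bubble. -/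
abbrev Corner : Type := Bool × Bool

/-- The quartic bubbles: the tetrahedron, and the pillow of colour `ℓ`, for each colour `ℓ`. -/
inductive BubbleKind : Type
  | tetra : BubbleKind
  | pillow (ℓ : Fin 3) : BubbleKind

namespace BubbleKind

/-- The edges of the quartic bubbles. In the tetrahedron (the complete graph on four nodes) the
three colours are the three perfect matchings. In the pillow of colour `ℓ` the nodes `(p, false)`
and `(p, true)` are joined by a double edge (the two colours distinct from `ℓ`), for `p = false` and
for `p = true`, and the two double edges are connected by two edges of colour `ℓ`. -/
def edge : BubbleKind → Fin 3 → Corner → Corner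
  | tetra, ℓ, k => ![(!k.1, k.2), (k.1, !k.2), (!k.1, !k.2)] ℓ
  | pillow ℓ', ℓ, k => if ℓ = ℓ' then (!k.1, k.2) else (k.1, !k.2)

theorem edge_edge (b : BubbleKind) (ℓ : Fin 3) (k : Corner) : b.edge ℓ (b.edge ℓ k) = k := by
  cases b with
  | tetra => fin_cases ℓ <;> simp [edge]
  | pillow m => by_cases h : ℓ = m <;> simp [edge, h]

theorem edge_ne (b : BubbleKind) (ℓ : Fin 3) (k : Corner) : b.edge ℓ k ≠ k := by
  obtain ⟨p, q⟩ := k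
  cases b with
  | tetra => fin_cases ℓ <;> simp [edge]
  | pillow m => by_cases h : ℓ = m <;> simp [edge, h]

end BubbleKind

namespace TensorGraph

variable {V : Type u} {W : Type v}

/-- Isomorphisms of four-coloured graphs. -/
structure Iso (G : TensorGraph V) (H : TensorGraph W) where
  toEquiv : V ≃ W
  map_edge : ∀ ℓ x, toEquiv (G.edge ℓ x) = H.edge ℓ (toEquiv x)
  map_line : ∀ x, toEquiv (G.line x) = H.line (toEquiv x)

/-- A vacuum graph has no external leg. -/
def IsVacuum (G : TensorGraph V) : Prop := ∀ x, G.line x ≠ x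

/-- `G` is a two-point graph: it has exactly two external legs, at the nodes `a` and `b`. -/
def IsTwoPoint (G : TensorGraph V) (a b : V) : Prop :=
  a ≠ b ∧ ∀ x, G.line x = x ↔ x = a ∨ x = b

/-- `G` is non-empty and any two nodes are joined by a path of edges and lines. -/
def Connected (G : TensorGraph V) : Prop :=
  Nonempty V ∧ ∀ x y, Relation.EqvGen (fun p q => q = G.line p ∨ ∃ ℓ, q = G.edge ℓ p) x y

/-- The bubbles: the connected components left after deletion of the propagator lines. -/
def Bubble (G : TensorGraph V) : Type u := Quot fun p q => ∃ ℓ, q = G.edge ℓ p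

/-- The propagator lines of a vacuum graph, as the pairs of nodes exchanged by `line`. -/
def Line (G : TensorGraph V) : Type u := Quot fun p q => q = G.line p

/-- The faces of colour `ℓ` of a vacuum graph: the cycles which alternate between propagator lines
and edges of colour `ℓ`, that is, the components of the subgraph formed by these two colours. -/
def Face (G : TensorGraph V) (ℓ : Fin 3) : Type u :=
  Quot fun p q => q = G.line p ∨ q = G.edge ℓ p

/-- The bubble `β` is isomorphic, as a three-coloured graph, to the quartic bubble `b`. -/
def HasKind (G : TensorGraph V) (β : G.Bubble) (b : BubbleKind) : Prop :=
  ∃ f : Corner → V, Function.Injective f ∧ (∀ x, Quot.mk _ x = β ↔ x ∈ Set.range f) ∧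
    ∀ ℓ k, f (b.edge ℓ k) = G.edge ℓ (f k)

/-- A graph of the quartic model: every bubble is a tetrahedron or a pillow. -/
def IsQuartic (G : TensorGraph V) : Prop := ∀ β : G.Bubble, ∃ b, G.HasKind β b

/-- The number of tetrahedral bubbles. -/
noncomputable def numTetra (G : TensorGraph V) : ℕ :=
  Nat.card {β : G.Bubble // G.HasKind β BubbleKind.tetra}

/-- The number of pillow bubbles, of any of the three colours. -/
noncomputable def numPillow (G : TensorGraph V) : ℕ :=
  Nat.card {β : G.Bubble // ∃ ℓ, G.HasKind β (BubbleKind.pillow ℓ)}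

/-- The number of propagator lines. -/
noncomputable def numLines (G : TensorGraph V) : ℕ := Nat.card G.Line

/-- The number of faces, of all three colours. -/
noncomputable def numFaces (G : TensorGraph V) : ℕ := ∑ ℓ, Nat.card (G.Face ℓ)

/-- The degree of a finite vacuum graph of the quartic model, where the scaling exponent `ρ` of a
bubble is `0` for the tetrahedron and `1 / 2` for the pillows. -/
noncomputable def degree (G : TensorGraph V) : ℚ :=
  3 + 3 / 2 * G.numLines - ((3 / 2 - 0) * G.numTetra + (3 / 2 - 1 / 2) * G.numPillow) - G.numFaces

/-- Vacuum leading order graphs of the quartic model. -/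
def IsLeadingOrder (G : TensorGraph V) : Prop :=
  G.IsVacuum ∧ G.Connected ∧ G.IsQuartic ∧ G.degree = 0

open Classical in
/-- The closure of a two-point graph: its two external legs are joined into one line. -/
noncomputable def close (G : TensorGraph V) (a b : V) (h : G.IsTwoPoint a b) : TensorGraph V where
  edge := G.edge
  edge_edge := G.edge_edge
  edge_ne := G.edge_ne
  line x := if x = a then b else if x = b then a else G.line x
  line_line x := by
    have ha : G.line a = a := (h.2 a).2 (Or.inl rfl)
    have hb : G.line b = b := (h.2 b).2 (Or.inr rfl)
    have hx := G.line_line x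
    have hab := h.1
    grind

open Classical in
/-- Insertion of a two-point graph `M` with external nodes `a` and `b` on the propagator line
which joins `x` to `G.line x`: this line is cut, its half at `x` is joined to the leg at `a` and its
half at `G.line x` to the leg at `b`. -/
noncomputable def insertAt (G : TensorGraph V) (x : V) (hx : G.line x ≠ x)
    (M : TensorGraph W) (a b : W) (hM : M.IsTwoPoint a b) : TensorGraph (V ⊕ W) where
  edge ℓ := Sum.map (G.edge ℓ) (M.edge ℓ)
  edge_edge ℓ y := by cases y <;> simp [G.edge_edge, M.edge_edge]
  edge_ne ℓ y := by cases y <;> simp [G.edge_ne, M.edge_ne]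
  line := Sum.elim
    (fun y => if y = x then Sum.inr a else if y = G.line x then Sum.inr b else Sum.inl (G.line y))
    (fun w => if w = a then Sum.inl x else if w = b then Sum.inl (G.line x) else Sum.inr (M.line w))
  line_line y := by
    have ha : M.line a = a := (hM.2 a).2 (Or.inl rfl)
    have hb : M.line b = b := (hM.2 b).2 (Or.inr rfl)
    have hab := hM.1
    have hxx := G.line_line x
    cases y with
    | inl y => have hy := G.line_line y; simp only [Sum.elim_inl]; grind
    | inr w => have hw := M.line_line w; simp only [Sum.elim_inr]; grind

/-- The first base graph: two tetrahedra, with corresponding nodes joined by four lines. -/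
def baseI : TensorGraph (Bool × Corner) where
  edge ℓ y := (y.1, BubbleKind.tetra.edge ℓ y.2)
  edge_edge ℓ y := by simp [BubbleKind.edge_edge]
  edge_ne ℓ y h := BubbleKind.edge_ne BubbleKind.tetra ℓ y.2 (congrArg Prod.snd h)
  line y := (!y.1, y.2)
  line_line y := by simp

/-- The second base graph, for each colour `ℓ`: a pillow of colour `ℓ` with two lines, each
parallel to one of the two double edges. -/
def baseII (ℓ : Fin 3) : TensorGraph Corner where
  edge := (BubbleKind.pillow ℓ).edge
  edge_edge := (BubbleKind.pillow ℓ).edge_edge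
  edge_ne := (BubbleKind.pillow ℓ).edge_ne
  line k := (k.1, !k.2)
  line_line k := by simp

/-- The elementary melon of type I: two tetrahedra, with three pairs of corresponding nodes joined
by lines, and an external leg at each of the two nodes of the fourth pair. -/
def melonI : TensorGraph (Bool × Corner) where
  edge := baseI.edge
  edge_edge := baseI.edge_edge
  edge_ne := baseI.edge_ne
  line y := if y.2 = (false, false) then y else (!y.1, y.2)
  line_line y := by by_cases h : y.2 = (false, false) <;> simp [h]

theorem melonI_isTwoPoint :
    melonI.IsTwoPoint (false, (false, false)) (true, (false, false)) := by
  refine ⟨by simp, ?_⟩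
  rintro ⟨s, p, q⟩
  cases s <;> cases p <;> cases q <;> simp [melonI]

/-- The elementary melon of type II, for each colour `ℓ`: a pillow of colour `ℓ` with one line,
parallel to one of the two double edges, and an external leg at each end of the other double edge. -/
def melonII (ℓ : Fin 3) : TensorGraph Corner where
  edge := (BubbleKind.pillow ℓ).edge
  edge_edge := (BubbleKind.pillow ℓ).edge_edge
  edge_ne := (BubbleKind.pillow ℓ).edge_ne
  line k := if k.1 = false then k else (k.1, !k.2)
  line_line k := by
    obtain ⟨p, q⟩ := k
    cases p <;> simp

theorem melonII_isTwoPoint (ℓ : Fin 3) :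
    (melonII ℓ).IsTwoPoint (false, false) (false, true) := by
  refine ⟨by simp, ?_⟩
  rintro ⟨p, q⟩
  cases p <;> cases q <;> simp [melonII]

/-- The vacuum melonic graphs: the graphs generated, up to isomorphism, by the base graphs and the
insertions of elementary melons of type I and of type II on propagator lines. -/
inductive IsMelonic : ∀ {V : Type u}, TensorGraph V → Prop
  | baseI {V : Type u} (G : TensorGraph V) : Nonempty (G.Iso baseI) → IsMelonic G
  | baseII {V : Type u} (G : TensorGraph V) (ℓ : Fin 3) : Nonempty (G.Iso (baseII ℓ)) → IsMelonic G
  | insertI {V W : Type u} (G : TensorGraph V) (H : TensorGraph W) (x : V) (hx : G.line x ≠ x) :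
      IsMelonic G → Nonempty (H.Iso (G.insertAt x hx melonI _ _ melonI_isTwoPoint)) → IsMelonic H
  | insertII {V W : Type u} (G : TensorGraph V) (H : TensorGraph W) (x : V) (hx : G.line x ≠ x)
      (ℓ : Fin 3) : IsMelonic G →
      Nonempty (H.Iso (G.insertAt x hx (melonII ℓ) _ _ (melonII_isTwoPoint ℓ))) → IsMelonic H

/-- `G` contains the graph `M` as a subgraph with external legs: the edges and the internal lines of
`M` are edges and internal lines of `G`; there is no condition on the legs of `M`, which lie on
lines or on legs of `G`. -/
def Contains (G : TensorGraph V) (M : TensorGraph W) : Prop :=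
  ∃ f : W → V, Function.Injective f ∧ (∀ ℓ w, f (M.edge ℓ w) = G.edge ℓ (f w)) ∧
    ∀ w, M.line w ≠ w → f (M.line w) = G.line (f w)

end TensorGraph

/-! The number of components of a subgraph spanned by some colours is the dimension of the space of
rational functions invariant under those colours, so counting faces becomes linear algebra. Counting
node by node turns the degree into `3 + pairSum / 2 - faceSum` (`degree_eq`), where `pairSum` counts
the two-coloured cycles inside bubbles. For edge colours i and j, the lines together with i and j
form a three-coloured graph, that is, a closed surface. Euler's inequality (`orbitCount_euler`) for
the three such surfaces, combined with submodularity of orbit counts, gives `2 * faceSum ≤ 6 * K +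
pairSum` for K components (`two_mul_faceSum_le`). Degree zero means equality with K = 1
(`IsExtremal`). Switching two lines that form a cut raises each face count by exactly one, because a
face crossing the cut uses both lines (`IsSwitch.orbits_eq`). So equality in the bound passes
through insertions (`insertAt_isExtremal`) and through cuts (`IsSwitch.restrict_isExtremal`). Hence
melonic graphs are extremal, and excising an elementary melon from an extremal graph leaves a
smaller extremal graph, unless the graph is a base graph. It remains to find a melon, by induction
on the number of nodes. If faces of two colours run between two lines through the same piece of the
graph, switching the lines creates more faces than a connected graph allows. The lines therefore
form a cut, and the far side is extremal, melonic by induction, and contains a melon avoiding the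
new line (`containsMelon_of_strands`). The double edge of a pillow provides such strands. If all
bubbles are tetrahedra, the three surfaces are orientable and attain Euler's bound, which forces a
face with only two lines; it joins two tetrahedra by two lines, and either a third line completes a
melon of type I or strands appear (`containsMelon_of_tetra`). For (b), the induction over melonic
graphs carries the stronger claim that for every line some melon has no internal line there. Applied
to the line closing the two legs, it leaves that melon inside the two-point graph. -/

open Module

/-! ### Orbit counts as dimensions of spaces of invariant functions -/

section Invariants

variable {V : Type u}

/-- The rational functions which are invariant under every map of the set `S`. -/
def invariantFun (S : Set (V → V)) : Submodule ℚ (V → ℚ) where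
  carrier := {φ | ∀ f ∈ S, ∀ x, φ (f x) = φ x}
  add_mem' h k f hf x := by simp [h f hf x, k f hf x]
  zero_mem' f _ x := rfl
  smul_mem' c φ h f hf x := by simp [h f hf x]

/-- The rational functions which change sign under every map of the set `S`. -/
def antiFun (S : Set (V → V)) : Submodule ℚ (V → ℚ) where
  carrier := {φ | ∀ f ∈ S, ∀ x, φ (f x) = -φ x}
  add_mem' h k f hf x := by simp [h f hf x, k f hf x]; ring
  zero_mem' f _ x := by simp
  smul_mem' c φ h f hf x := by simp [h f hf x]

theorem mem_invariantFun {S : Set (V → V)} {φ : V → ℚ} :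
    φ ∈ invariantFun S ↔ ∀ f ∈ S, ∀ x, φ (f x) = φ x := Iff.rfl

theorem invariantFun_union (S T : Set (V → V)) :
    invariantFun (S ∪ T) = invariantFun S ⊓ invariantFun T := by
  ext φ
  simp only [mem_invariantFun, Submodule.mem_inf, Set.mem_union, or_imp, forall_and]

theorem invariantFun_anti {S T : Set (V → V)} (h : S ⊆ T) : invariantFun T ≤ invariantFun S :=
  fun _ hφ f hf => hφ f (h hf)

/-- The number of orbits of the maps of the set `S`. -/
noncomputable def orbitCount (S : Set (V → V)) : ℕ := finrank ℚ (invariantFun S)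

/-- Functions on the quotient are the invariant functions. -/
def quotFunEquiv (S : Set (V → V)) (r : V → V → Prop) (hr : ∀ p q, r p q ↔ ∃ f ∈ S, q = f p) :
    (Quot r → ℚ) ≃ₗ[ℚ] invariantFun S where
  toFun g := ⟨fun x => g (Quot.mk r x), fun f hf x =>
    congrArg g (Quot.sound ((hr _ _).2 ⟨f, hf, rfl⟩)).symm⟩
  map_add' _ _ := rfl
  map_smul' _ _ := rfl
  invFun φ := Quot.lift φ.1 (by
    intro p q h
    obtain ⟨f, hf, rfl⟩ := (hr p q).1 h
    exact (φ.2 f hf p).symm)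
  left_inv g := by
    funext q
    induction q using Quot.ind
    rfl
  right_inv φ := rfl

theorem card_quot_eq_orbitCount [Finite V] (S : Set (V → V)) (r : V → V → Prop)
    (hr : ∀ p q, r p q ↔ ∃ f ∈ S, q = f p) : Nat.card (Quot r) = orbitCount S := by
  have : Fintype (Quot r) := Fintype.ofFinite _
  rw [orbitCount, ← (quotFunEquiv S r hr).finrank_eq, Module.finrank_fintype_fun_eq_card,
    Nat.card_eq_fintype_card]

-- Each class spreads its value evenly over its members, so counts of classes can be compared node
-- by node.
open Classical in
theorem sum_quot_eq_sum_div_card [Fintype V] (r : V → V → Prop) [Fintype (Quot r)]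
    (g : Quot r → ℚ) :
    ∑ q, g q = ∑ x, g (Quot.mk r x) / Nat.card {y // Quot.mk r y = Quot.mk r x} := by
  rw [← Finset.sum_fiberwise (s := Finset.univ) (g := fun x => Quot.mk r x)]
  refine Finset.sum_congr rfl fun q _ => ?_
  have h : ∀ x ∈ Finset.univ.filter (fun x => Quot.mk r x = q),
      g (Quot.mk r x) / Nat.card {y // Quot.mk r y = Quot.mk r x}
        = g q / (Finset.univ.filter (fun x => Quot.mk r x = q)).card := by
    intro x hx
    obtain rfl := (Finset.mem_filter.1 hx).2
    rw [Nat.card_eq_fintype_card, Fintype.card_subtype]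
  rw [Finset.sum_congr rfl h, Finset.sum_const, nsmul_eq_mul]
  have h0 : ((Finset.univ.filter (fun x => Quot.mk r x = q)).card : ℚ) ≠ 0 := by
    obtain ⟨x, rfl⟩ := Quot.exists_rep q
    exact Nat.cast_ne_zero.2
      (Finset.card_ne_zero_of_mem (Finset.mem_filter.2 ⟨Finset.mem_univ x, rfl⟩))
  field_simp

/-- A set which is invariant under the relation contains the class of each of its elements. -/
theorem mem_of_quot_mk_eq {r : V → V → Prop} {s : Set V} (hs : ∀ p q, r p q → (p ∈ s ↔ q ∈ s))
    {x y : V} (h : Quot.mk r y = Quot.mk r x) (hx : x ∈ s) : y ∈ s := by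
  have := congrArg (Quot.lift (fun v => v ∈ s) fun p q hpq => propext (hs p q hpq)) h
  exact this.mpr hx

theorem orbitCount_eq_sum [Fintype V] (S : Set (V → V)) (r : V → V → Prop)
    (hr : ∀ p q, r p q ↔ ∃ f ∈ S, q = f p) (w : V → ℚ)
    (hw : ∀ x, w x = (Nat.card {y // Quot.mk r y = Quot.mk r x} : ℚ)⁻¹) :
    (orbitCount S : ℚ) = ∑ x, w x := by
  have : Fintype (Quot r) := Fintype.ofFinite _
  rw [← card_quot_eq_orbitCount S r hr]
  have := sum_quot_eq_sum_div_card r (fun _ => (1 : ℚ))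
  simp only [Finset.sum_const, nsmul_eq_mul, mul_one, Finset.card_univ] at this
  rw [Nat.card_eq_fintype_card, this]
  exact Finset.sum_congr rfl fun x _ => by rw [hw, one_div]

/-- Two commuting involutions without fixed points: the orbit of `x` has two elements if they agree
at `x` and four otherwise. -/
theorem card_orbit_pair {a b : V → V} (ha : ∀ x, a (a x) = x) (hb : ∀ x, b (b x) = x)
    (ha' : ∀ x, a x ≠ x) (hb' : ∀ x, b x ≠ x) (hab : ∀ x, a (b x) = b (a x))
    (r : V → V → Prop) (hr : ∀ p q, r p q ↔ q = a p ∨ q = b p) (x : V) [Decidable (a x = b x)] :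
    Nat.card {y // Quot.mk r y = Quot.mk r x} = if a x = b x then 2 else 4 := by
  classical
  have h1 : Quot.mk r (a x) = Quot.mk r x := (Quot.sound ((hr _ _).2 (Or.inl rfl))).symm
  have h2 : ∀ x, Quot.mk r (b x) = Quot.mk r x :=
    fun x => (Quot.sound ((hr _ _).2 (Or.inr rfl))).symm
  have key : ∀ y, Quot.mk r y = Quot.mk r x ↔ y ∈ ({x, a x, b x, b (a x)} : Finset V) := by
    intro y
    constructor
    · intro h
      have := mem_of_quot_mk_eq (s := {y | y ∈ ({x, a x, b x, b (a x)} : Finset V)})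
        (by
          intro p q hpq
          have hA := ha p; have hB := hb p; have hC := hab x; have hD := ha x; have hE := hb x
          have hF := hb (a x); have hG := hab (a x)
          have hH := ha (b x)
          rcases (hr p q).1 hpq with rfl | rfl <;>
            simp only [Set.mem_ofPred_eq, Finset.mem_insert, Finset.mem_singleton] <;> grind)
        h (by simp)
      exact this
    · simp only [Finset.mem_insert, Finset.mem_singleton]
      rintro (rfl | rfl | rfl | rfl)
      · rfl
      · exact h1
      · exact h2 x
      · rw [h2, h1]
  rw [Nat.card_congr (Equiv.subtypeEquivRight key), Nat.card_eq_fintype_card, Fintype.card_coe]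
  have hA := ha x; have hB := hb x; have hA' := ha' x; have hB' := hb' x
  have hC := hb' (a x); have hD := hb (a x); have hE := ha' (b x); have hF := hab x
  split_ifs with h
  · have : ({x, a x, b x, b (a x)} : Finset V) = {x, a x} := by
      ext y
      simp only [Finset.mem_insert, Finset.mem_singleton]
      grind
    rw [this, Finset.card_pair (Ne.symm hA')]
  · rw [Finset.card_insert_of_notMem, Finset.card_insert_of_notMem, Finset.card_pair]
    all_goals try simp only [Finset.mem_insert, Finset.mem_singleton]
    all_goals grind

open Classical in
theorem orbitCount_pair_eq_sum [Fintype V] {a b : V → V} (ha : ∀ x, a (a x) = x)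
    (hb : ∀ x, b (b x) = x) (ha' : ∀ x, a x ≠ x) (hb' : ∀ x, b x ≠ x)
    (hab : ∀ x, a (b x) = b (a x)) :
    (orbitCount {a, b} : ℚ) = ∑ x, if a x = b x then (1 / 2 : ℚ) else 1 / 4 := by
  refine orbitCount_eq_sum {a, b} (fun p q => q = a p ∨ q = b p) (by simp) _ fun x => ?_
  rw [card_orbit_pair ha hb ha' hb' hab _ (fun _ _ => Iff.rfl)]
  split_ifs <;> norm_num

theorem two_mul_orbitCount_singleton [Finite V] {a : V → V} (ha : ∀ x, a (a x) = x)
    (ha' : ∀ x, a x ≠ x) : 2 * orbitCount {a} = Nat.card V := by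
  have : Fintype V := Fintype.ofFinite V
  -- The pair formula is used with both involutions equal, so every orbit has two elements.
  have h := orbitCount_pair_eq_sum ha ha ha' ha' (fun _ => rfl)
  simp only [if_true, Finset.sum_const, nsmul_eq_mul, Finset.card_univ, Set.pair_eq_singleton] at h
  rw [Nat.card_eq_fintype_card]
  have : (2 * orbitCount {a} : ℚ) = Fintype.card V := by rw [h]; ring
  exact_mod_cast this

/-- A sign-changing function that vanishes at one point of an orbit vanishes on the whole orbit, so
its values at representatives determine it. -/
theorem finrank_antiFun_le [Finite V] (S : Set (V → V)) :
    finrank ℚ (antiFun S) ≤ orbitCount S := by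
  classical
  let r : V → V → Prop := fun p q => ∃ f ∈ S, q = f p
  have : Fintype (Quot r) := Fintype.ofFinite _
  rw [orbitCount, ← (quotFunEquiv S r fun _ _ => Iff.rfl).finrank_eq]
  let L : antiFun S →ₗ[ℚ] (Quot r → ℚ) :=
    { toFun := fun φ q => φ.1 (Quot.out q)
      map_add' := fun _ _ => rfl
      map_smul' := fun _ _ => rfl }
  refine LinearMap.finrank_le_finrank_of_injective (f := L) ?_
  rw [← LinearMap.ker_eq_bot, LinearMap.ker_eq_bot']
  rintro ⟨φ, hφ⟩ h
  ext x
  have hx : φ (Quot.out (Quot.mk r x)) = 0 := congrFun h (Quot.mk r x)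
  refine mem_of_quot_mk_eq (r := r) (s := {v | φ v = 0}) ?_ (Quot.out_eq (Quot.mk r x)).symm hx
  rintro p q ⟨f, hf, rfl⟩
  simp [hφ f hf p]

/-- A functional killing the sum of the three spaces kills the sum of the indicators of `x` and `f
x` for each involution `f`; its values on indicators therefore change sign under all three. This
bounds the annihilator. -/
theorem card_le_finrank_add_finrank_antiFun [Finite V] {α β γ : V → V} (hα : ∀ x, α (α x) = x)
    (hβ : ∀ x, β (β x) = x) (hγ : ∀ x, γ (γ x) = x) :
    Nat.card V ≤ finrank ℚ (invariantFun {α} ⊔ invariantFun {β} ⊔ invariantFun {γ} :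
      Submodule ℚ (V → ℚ)) + finrank ℚ (antiFun {α, β, γ}) := by
  classical
  have : Fintype V := Fintype.ofFinite V
  set s : Submodule ℚ (V → ℚ) := invariantFun {α} ⊔ invariantFun {β} ⊔ invariantFun {γ} with hs
  have h := Subspace.finrank_add_finrank_dualAnnihilator_eq s
  rw [Module.finrank_fintype_fun_eq_card, ← Nat.card_eq_fintype_card] at h
  rw [← h]
  refine Nat.add_le_add_left ?_ _
  let L : s.dualAnnihilator →ₗ[ℚ] antiFun {α, β, γ} :=
    { toFun := fun F => ⟨fun v => F.1 (Pi.single v 1), by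
        have key : ∀ f : V → V, invariantFun {f} ≤ s → (∀ x, f (f x) = x) →
            ∀ x, F.1 (Pi.single (f x) 1) = - F.1 (Pi.single x 1) := by
          intro f hf hff x
          have hmem : (Pi.single (f x) 1 + Pi.single x 1 : V → ℚ) ∈ invariantFun {f} := by
            rintro g rfl y
            have := hff x; have := hff y
            simp only [Pi.add_apply, Pi.single_apply]
            grind
          have := (Submodule.mem_dualAnnihilator _).1 F.2 _ (hf hmem)
          rw [map_add] at this
          linarith
        rintro f (rfl | rfl | rfl) x
        · exact key _ (le_sup_left.trans le_sup_left) hα x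
        · exact key _ (le_sup_right.trans le_sup_left) hβ x
        · exact key _ le_sup_right hγ x⟩
      map_add' := fun _ _ => rfl
      map_smul' := fun _ _ => rfl }
  refine LinearMap.finrank_le_finrank_of_injective (f := L) ?_
  rw [← LinearMap.ker_eq_bot, LinearMap.ker_eq_bot']
  rintro ⟨F, hF⟩ h
  ext x
  exact congrFun (congrArg Subtype.val h) x

theorem invariantFun_pair (a b : V → V) :
    invariantFun {a, b} = invariantFun {a} ⊓ invariantFun {b} := by
  rw [← invariantFun_union, Set.singleton_union]

/-- Euler's inequality for three involutions without fixed points (a three-coloured graph, seen as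
a map on a closed surface), with the gain by one for every non-orientable component. -/
theorem orbitCount_euler [Finite V] {α β γ : V → V} (hα : ∀ x, α (α x) = x)
    (hβ : ∀ x, β (β x) = x) (hγ : ∀ x, γ (γ x) = x) (hα' : ∀ x, α x ≠ x)
    (hβ' : ∀ x, β x ≠ x) (hγ' : ∀ x, γ x ≠ x) :
    2 * (orbitCount {α, β} + orbitCount {α, γ} + orbitCount {β, γ}) ≤
      Nat.card V + 2 * orbitCount {α, β, γ} + 2 * finrank ℚ (antiFun {α, β, γ}) := by
  have h0 := card_le_finrank_add_finrank_antiFun hα hβ hγ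
  have hA := two_mul_orbitCount_singleton hα hα'
  have hB := two_mul_orbitCount_singleton hβ hβ'
  have hC := two_mul_orbitCount_singleton hγ hγ'
  have hABC : invariantFun {α, β, γ} =
      invariantFun {α} ⊓ invariantFun {γ} ⊓ (invariantFun {β} ⊓ invariantFun {γ}) := by
    rw [← invariantFun_pair, ← invariantFun_pair, ← invariantFun_union]
    congr 1
    ext
    simp
    tauto
  unfold orbitCount at hA hB hC ⊢
  rw [hABC, invariantFun_pair α β, invariantFun_pair α γ, invariantFun_pair β γ]
  generalize invariantFun {α} = A at *
  generalize invariantFun {β} = B at *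
  generalize invariantFun {γ} = C at *
  have h1 := Submodule.finrank_sup_add_finrank_inf_eq A B
  have h2 := Submodule.finrank_sup_add_finrank_inf_eq (A ⊔ B) C
  have h3 := Submodule.finrank_sup_add_finrank_inf_eq (A ⊓ C) (B ⊓ C)
  -- Besides `h0`, this failure of distributivity is the only loss in the count; the rest is the
  -- dimension formula.
  have h4 : (A ⊓ C) ⊔ (B ⊓ C) ≤ (A ⊔ B) ⊓ C :=
    sup_le (inf_le_inf_right _ le_sup_left) (inf_le_inf_right _ le_sup_right)
  have h5 := Submodule.finrank_mono h4
  omega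

/-- The dimension formula, as both invariant spaces lie in that of `S ∩ T` and meet in that of `S ∪
T`. -/
theorem orbitCount_submodular [Finite V] (S T : Set (V → V)) :
    orbitCount S + orbitCount T ≤ orbitCount (S ∩ T) + orbitCount (S ∪ T) := by
  have h1 := Submodule.finrank_sup_add_finrank_inf_eq (invariantFun S) (invariantFun T)
  have h2 : invariantFun S ⊔ invariantFun T ≤ invariantFun (S ∩ T) :=
    sup_le (invariantFun_anti Set.inter_subset_left) (invariantFun_anti Set.inter_subset_right)
  have h3 := Submodule.finrank_mono h2
  rw [← invariantFun_union] at h1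
  simp only [orbitCount]
  omega

theorem orbitCount_anti [Finite V] {S T : Set (V → V)} (h : S ⊆ T) :
    orbitCount T ≤ orbitCount S := Submodule.finrank_mono (invariantFun_anti h)

/-- The linear form whose kernel are the functions with equal values at `p` and `q`. -/
def valueDiff (p q : V) : (V → ℚ) →ₗ[ℚ] ℚ where
  toFun φ := φ p - φ q
  map_add' φ ψ := by simp; ring
  map_smul' c φ := by simp; ring

theorem mem_ker_valueDiff {p q : V} {φ : V → ℚ} :
    φ ∈ LinearMap.ker (valueDiff p q) ↔ φ p = φ q := sub_eq_zero

/-- Adding one identification lowers the number of orbits by at most one. -/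
theorem finrank_le_finrank_inf_ker_add_one [Finite V] (P : Submodule ℚ (V → ℚ)) (p q : V) :
    finrank ℚ P ≤ finrank ℚ (P ⊓ LinearMap.ker (valueDiff p q) : Submodule ℚ (V → ℚ)) + 1 := by
  have h := Submodule.finrank_sup_add_finrank_inf_eq P (LinearMap.ker (valueDiff p q))
  have h1 := LinearMap.finrank_range_add_finrank_ker (valueDiff p q)
  have h2 := Submodule.finrank_le (P ⊔ LinearMap.ker (valueDiff p q))
  have h3 := Submodule.finrank_le (LinearMap.range (valueDiff p q))
  rw [finrank_self] at h3
  omega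

theorem orbitCount_pos [Finite V] [Nonempty V] (S : Set (V → V)) : 0 < orbitCount S := by
  rw [← card_quot_eq_orbitCount S _ fun _ _ => Iff.rfl]
  have : Nonempty (Quot fun p q => ∃ f ∈ S, q = f p) := ⟨Quot.mk _ (Classical.arbitrary V)⟩
  exact Nat.card_pos

/-- There is exactly one orbit if and only if all invariant functions are constant. -/
theorem orbitCount_eq_one_iff [Finite V] [Nonempty V] (S : Set (V → V)) :
    orbitCount S = 1 ↔ ∀ φ ∈ invariantFun S, ∀ x y, φ x = φ y := by
  constructor
  · intro h φ hφ x y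
    rw [← card_quot_eq_orbitCount S _ fun _ _ => Iff.rfl, Nat.card_eq_one_iff_unique] at h
    obtain ⟨h, -⟩ := h
    refine mem_of_quot_mk_eq (r := fun p q => ∃ f ∈ S, q = f p) (s := {v | φ v = φ y}) ?_
      (h.elim _ _) rfl
    rintro p q ⟨f, hf, rfl⟩
    simp [hφ f hf p]
  · intro h
    have x : V := Classical.arbitrary V
    refine le_antisymm ?_ (orbitCount_pos S)
    rw [orbitCount]
    let L : invariantFun S →ₗ[ℚ] ℚ := (LinearMap.proj x).comp (invariantFun S).subtype
    rw [← finrank_self ℚ]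
    refine LinearMap.finrank_le_finrank_of_injective (f := L) ?_
    rw [← LinearMap.ker_eq_bot, LinearMap.ker_eq_bot']
    rintro ⟨φ, hφ⟩ h'
    ext y
    exact (h φ hφ y x).trans h'

/-- A union of cycles of two involutions cannot be left at exactly one node: if `Z` is closed under
`g` and closed under `l` except at `p` and `q`, then `p` and `q` lie on the same cycle. -/
theorem eq_of_invariantFun_of_cut [Finite V] {l g : V → V} (hl : ∀ x, l (l x) = x)
    (hl' : ∀ x, l x ≠ x) (hg : ∀ x, g (g x) = x) (hg' : ∀ x, g x ≠ x) {Z : Set V} {p q : V}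
    (hgZ : ∀ v ∈ Z, g v ∈ Z) (hlZ : ∀ v ∈ Z, v ≠ p → v ≠ q → l v ∈ Z) (hp : p ∈ Z)
    (hlp : l p ∉ Z) {φ : V → ℚ} (hφ : φ ∈ invariantFun {l, g}) : φ p = φ q := by
  classical
  have : Fintype V := Fintype.ofFinite V
  by_contra hpq
  have h1 : ∀ x, φ (l x) = φ x := hφ l (by simp)
  have h2 : ∀ x, φ (g x) = φ x := hφ g (by simp)
  -- If `φ p ≠ φ q`, then `g` pairs off `T` while `l` pairs off `T` without `p`, so `T` would have
  -- both parities.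
  let T : Finset V := Finset.univ.filter fun v => v ∈ Z ∧ φ v = φ p
  have hT : ∀ v, v ∈ T ↔ v ∈ Z ∧ φ v = φ p := fun v => by simp [T]
  have e1 : ∑ v ∈ T, (1 : ZMod 2) = 0 :=
    Finset.sum_involution (fun v _ => g v) (fun _ _ => by decide) (fun v _ _ => hg' v)
      (fun v hv => (hT _).2 ⟨hgZ v ((hT v).1 hv).1, by rw [h2, ((hT v).1 hv).2]⟩)
      (fun v _ => hg v)
  have e2 : ∑ v ∈ T.erase p, (1 : ZMod 2) = 0 := by
    refine Finset.sum_involution (fun v _ => l v) (fun _ _ => by decide) (fun v _ _ => hl' v)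
      (fun v hv => ?_) (fun v _ => hl v)
    obtain ⟨hvp, hv⟩ := Finset.mem_erase.1 hv
    obtain ⟨hvZ, hv⟩ := (hT v).1 hv
    have hvq : v ≠ q := by rintro rfl; exact hpq hv.symm
    refine Finset.mem_erase.2 ⟨?_, (hT _).2 ⟨hlZ v hvZ hvp hvq, by rw [h1, hv]⟩⟩
    rintro rfl
    exact hlp (by rwa [hl])
  rw [← Finset.add_sum_erase _ _ ((hT p).2 ⟨hp, rfl⟩), e2] at e1
  exact absurd e1 (by decide)

end Invariants

/-! ### Symmetries of the quartic bubbles -/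

namespace BubbleKind

/-- The translations of the corners, which are automorphisms of all quartic bubbles. -/
def translate (k₀ k : Corner) : Corner := (k.1 ^^ k₀.1, k.2 ^^ k₀.2)

theorem translate_false (k₀ : Corner) : translate k₀ (false, false) = k₀ := by
  simp [translate]

theorem translate_injective (k₀ : Corner) : Function.Injective (translate k₀) := by
  rintro ⟨a, b⟩ ⟨c, d⟩ h
  simpa [translate] using h

theorem edge_translate (b : BubbleKind) (ℓ : Fin 3) (k₀ k : Corner) :
    b.edge ℓ (translate k₀ k) = translate k₀ (b.edge ℓ k) := by
  cases b with
  | tetra => fin_cases ℓ <;> simp [edge, translate]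
  | pillow m => by_cases h : ℓ = m <;> simp [edge, translate, h]

theorem edge_comm (b : BubbleKind) (i j : Fin 3) (k : Corner) :
    b.edge i (b.edge j k) = b.edge j (b.edge i k) := by
  cases b with
  | tetra => fin_cases i <;> fin_cases j <;> simp [edge]
  | pillow m => by_cases h : i = m <;> by_cases h' : j = m <;> simp [edge, h, h']

theorem exists_edge_eq (b : BubbleKind) :
    ∃ i j, ∀ k, b.edge i k = (!k.1, k.2) ∧ b.edge j k = (k.1, !k.2) := by
  cases b with
  | tetra => exact ⟨0, 1, fun k => by simp [edge]⟩
  | pillow m =>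
    have h : m + 1 ≠ m := by fin_cases m <;> decide
    exact ⟨m, m + 1, fun k => by simp [edge, h]⟩

end BubbleKind

/-! ### The degree through orbit counts, and the bound on faces -/

namespace TensorGraph

variable {V : Type u} {W : Type v}

/-- All four colours of a graph together; `none` is the colour of the propagator lines. -/
def col (G : TensorGraph V) : Option (Fin 3) → V → V
  | none => G.line
  | some ℓ => G.edge ℓ

theorem col_col (G : TensorGraph V) (c : Option (Fin 3)) (x : V) : G.col c (G.col c x) = x := by
  cases c
  · exact G.line_line x
  · exact G.edge_edge _ x

/-- The number of components of the subgraph formed by the edges of the colours in `A`. -/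
noncomputable def orbits (G : TensorGraph V) (A : Set (Option (Fin 3))) : ℕ :=
  orbitCount (G.col '' A)

/-- The node `x` lies in a bubble of the kind `b`. -/
def KindAt (G : TensorGraph V) (b : BubbleKind) (x : V) : Prop :=
  ∃ f : Corner → V, Function.Injective f ∧ f (false, false) = x ∧
    ∀ ℓ k, f (b.edge ℓ k) = G.edge ℓ (f k)

/-- In every bubble two of the colours flip the two coordinates of a corner, so all corners are
reached from one. -/
theorem mem_of_corner {G : TensorGraph V} {b : BubbleKind} {f : Corner → V}
    (hf : ∀ ℓ k, f (b.edge ℓ k) = G.edge ℓ (f k)) {s : Set V} (hs : ∀ ℓ, ∀ v ∈ s, G.edge ℓ v ∈ s)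
    (h : f (false, false) ∈ s) (k : Corner) : f k ∈ s := by
  obtain ⟨i, j, hij⟩ := b.exists_edge_eq
  have h1 : ∀ k, f k ∈ s → f (!k.1, k.2) ∈ s := fun k hk => by
    rw [← (hij k).1, hf]; exact hs _ _ hk
  have h2 : ∀ k, f k ∈ s → f (k.1, !k.2) ∈ s := fun k hk => by
    rw [← (hij k).2, hf]; exact hs _ _ hk
  obtain ⟨p, q⟩ := k
  cases p <;> cases q
  · exact h
  · exact h2 _ h
  · exact h1 _ h
  · exact h2 _ (h1 _ h)

theorem mk_eq_iff_mem_range {G : TensorGraph V} {b : BubbleKind} {f : Corner → V}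
    (hf : ∀ ℓ k, f (b.edge ℓ k) = G.edge ℓ (f k)) (y : V) :
    Quot.mk (fun p q => ∃ ℓ, q = G.edge ℓ p) y = Quot.mk _ (f (false, false)) ↔
      y ∈ Set.range f := by
  constructor
  · intro h
    refine mem_of_quot_mk_eq (s := Set.range f) ?_ h ⟨_, rfl⟩
    rintro p q ⟨ℓ, rfl⟩
    constructor
    · rintro ⟨k, rfl⟩
      exact ⟨_, hf ℓ k⟩
    · rintro ⟨k, hk⟩
      exact ⟨b.edge ℓ k, by rw [hf, hk, G.edge_edge]⟩
  · rintro ⟨k, rfl⟩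
    exact mem_of_corner hf (s := {y | Quot.mk (fun p q => ∃ ℓ, q = G.edge ℓ p) y =
      Quot.mk _ (f (false, false))})
      (fun ℓ v hv => (Quot.sound (r := fun p q => ∃ ℓ, q = G.edge ℓ p) ⟨ℓ, rfl⟩).symm.trans hv)
      rfl k

/-- Translations act transitively on corners by automorphisms, so any node of the bubble can serve
as base corner. -/
theorem hasKind_mk_iff {G : TensorGraph V} {b : BubbleKind} {x : V} :
    G.HasKind (Quot.mk _ x) b ↔ G.KindAt b x := by
  constructor
  · rintro ⟨f, hf, hr, he⟩
    obtain ⟨k₀, rfl⟩ := (hr x).1 rfl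
    exact ⟨fun k => f (BubbleKind.translate k₀ k), hf.comp (BubbleKind.translate_injective k₀),
      congrArg f (BubbleKind.translate_false k₀), fun ℓ k => by rw [← he, BubbleKind.edge_translate]⟩
  · rintro ⟨f, hf, rfl, he⟩
    exact ⟨f, hf, mk_eq_iff_mem_range he, he⟩

theorem isQuartic_iff {G : TensorGraph V} : G.IsQuartic ↔ ∀ x, ∃ b, G.KindAt b x := by
  constructor
  · intro h x
    obtain ⟨b, hb⟩ := h (Quot.mk _ x)
    exact ⟨b, hasKind_mk_iff.1 hb⟩
  · intro h β
    obtain ⟨x, rfl⟩ := Quot.exists_rep β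
    obtain ⟨b, hb⟩ := h x
    exact ⟨b, hasKind_mk_iff.2 hb⟩

theorem KindAt.map {G : TensorGraph V} {H : TensorGraph W} {g : V → W}
    (hg : Function.Injective g) (he : ∀ ℓ x, g (G.edge ℓ x) = H.edge ℓ (g x)) {b : BubbleKind}
    {x : V} (h : G.KindAt b x) : H.KindAt b (g x) := by
  obtain ⟨f, hf, rfl, hf'⟩ := h
  exact ⟨g ∘ f, hg.comp hf, rfl, fun ℓ k => by simp [hf', he]⟩

theorem KindAt.of_map {G : TensorGraph V} {H : TensorGraph W} {g : V → W}
    (hg : Function.Injective g) (he : ∀ ℓ x, g (G.edge ℓ x) = H.edge ℓ (g x)) {b : BubbleKind}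
    {x : V} (h : H.KindAt b (g x)) : G.KindAt b x := by
  obtain ⟨f, hf, hx, hf'⟩ := h
  have hr : ∀ k, f k ∈ Set.range g := by
    refine mem_of_corner hf' ?_ ⟨x, hx.symm⟩
    rintro ℓ _ ⟨v, rfl⟩
    exact ⟨_, he ℓ v⟩
  choose f' hf'' using hr
  refine ⟨f', fun k k' h => hf ?_, hg ?_, fun ℓ k => hg ?_⟩
  · rw [← hf'', ← hf'', h]
  · rw [hf'', hx]
  · rw [hf'', he, hf'', hf']

theorem IsQuartic.edge_comm {G : TensorGraph V} (h : G.IsQuartic) (i j : Fin 3) (x : V) :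
    G.edge i (G.edge j x) = G.edge j (G.edge i x) := by
  obtain ⟨b, f, -, rfl, hf⟩ := isQuartic_iff.1 h x
  rw [← hf, ← hf, ← hf, ← hf, b.edge_comm]

theorem KindAt.edge_eq_iff {G : TensorGraph V} {b : BubbleKind} {x : V} (h : G.KindAt b x)
    (i j : Fin 3) :
    G.edge i x = G.edge j x ↔ b.edge i (false, false) = b.edge j (false, false) := by
  obtain ⟨f, hf, rfl, hf'⟩ := h
  rw [← hf', ← hf', hf.eq_iff]

theorem KindAt.edge_eq_iff_tetra {G : TensorGraph V} {x : V} (h : G.KindAt .tetra x)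
    (i j : Fin 3) : G.edge i x = G.edge j x ↔ i = j := by
  rw [h.edge_eq_iff]
  fin_cases i <;> fin_cases j <;> simp [BubbleKind.edge]

theorem KindAt.edge_eq_iff_pillow {G : TensorGraph V} {x : V} {ℓ : Fin 3}
    (h : G.KindAt (.pillow ℓ) x) (i j : Fin 3) :
    G.edge i x = G.edge j x ↔ (i = ℓ ↔ j = ℓ) := by
  rw [h.edge_eq_iff]
  by_cases hi : i = ℓ <;> by_cases hj : j = ℓ <;> simp [BubbleKind.edge, hi, hj]

theorem not_kindAt_pillow_of_tetra {G : TensorGraph V} {x : V} (h : G.KindAt .tetra x)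
    (ℓ : Fin 3) : ¬ G.KindAt (.pillow ℓ) x := by
  intro h'
  have h1 := (h.edge_eq_iff_tetra (ℓ + 1) (ℓ + 2)).1
    ((h'.edge_eq_iff_pillow _ _).2 (by fin_cases ℓ <;> decide))
  revert h1
  fin_cases ℓ <;> decide

/-- The sum over the pairs of colours of the number of cycles alternating between them. -/
noncomputable def pairSum (G : TensorGraph V) : ℕ :=
  G.orbits {some 0, some 1} + G.orbits {some 0, some 2} + G.orbits {some 1, some 2}

/-- The number of faces, as a sum of orbit counts. -/
noncomputable def faceSum (G : TensorGraph V) : ℕ :=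
  G.orbits {none, some 0} + G.orbits {none, some 1} + G.orbits {none, some 2}

theorem numFaces_eq [Finite V] (G : TensorGraph V) : G.numFaces = G.faceSum := by
  have h : ∀ ℓ, Nat.card (G.Face ℓ) = G.orbits {none, some ℓ} := fun ℓ =>
    card_quot_eq_orbitCount _ _ (by simp [col])
  simp [numFaces, faceSum, Fin.sum_univ_three, h]

theorem card_bubble [Finite V] {G : TensorGraph V} (h : G.IsQuartic) (x : V) :
    Nat.card {y // Quot.mk (fun p q => ∃ ℓ, q = G.edge ℓ p) y = Quot.mk _ x} = 4 := by
  obtain ⟨b, f, hf, rfl, hf'⟩ := isQuartic_iff.1 h x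
  rw [Nat.card_congr (Equiv.subtypeEquivRight (mk_eq_iff_mem_range hf')),
    Nat.card_congr (Equiv.ofInjective f hf).symm]
  simp

/-- The number of nodes is four times the number of bubbles. -/
theorem card_eq_four_mul [Finite V] {G : TensorGraph V} (h : G.IsQuartic) :
    Nat.card V = 4 * G.orbits {some 0, some 1, some 2} := by
  have : Fintype V := Fintype.ofFinite V
  have h1 := orbitCount_eq_sum (G.col '' {some 0, some 1, some 2})
    (fun p q => ∃ ℓ, q = G.edge ℓ p) (by
      intro p q
      simp [col, Fin.exists_fin_succ]) (fun _ => 1 / 4)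
    (fun x => by rw [card_bubble h]; norm_num)
  simp only [Finset.sum_const, nsmul_eq_mul, Finset.card_univ] at h1
  rw [Nat.card_eq_fintype_card, orbits]
  have : (Fintype.card V : ℚ) = (4 * orbitCount (G.col '' {some 0, some 1, some 2}) : ℕ) := by
    push_cast
    rw [h1]
    ring
  exact_mod_cast this

theorem two_mul_numLines [Finite V] {G : TensorGraph V} (h : G.IsVacuum) :
    2 * G.numLines = Nat.card V := by
  rw [← two_mul_orbitCount_singleton G.line_line h, numLines,
    ← card_quot_eq_orbitCount {G.line} (fun p q => q = G.line p) (by simp)]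
  rfl

open Classical in
theorem card_bubble_eq_sum [Fintype V] {G : TensorGraph V} (h : G.IsQuartic)
    (P : G.Bubble → Prop) :
    (Nat.card {β // P β} : ℚ) = ∑ x, if P (Quot.mk _ x) then (1 / 4 : ℚ) else 0 := by
  let I : Fintype (Quot fun p q => ∃ ℓ, q = G.edge ℓ p) := Fintype.ofFinite _
  let J : Fintype G.Bubble := I
  have h1 := sum_quot_eq_sum_div_card (fun p q => ∃ ℓ, q = G.edge ℓ p)
    (fun β => if P β then (1 : ℚ) else 0)
  rw [Nat.card_eq_fintype_card, Fintype.card_subtype, Finset.card_filter]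
  push_cast
  refine h1.trans (Finset.sum_congr rfl fun x _ => ?_)
  rw [card_bubble h, ite_div]
  norm_num

open Classical in
theorem orbits_some_pair [Fintype V] {G : TensorGraph V} (h : G.IsQuartic) (i j : Fin 3) :
    (G.orbits {some i, some j} : ℚ) =
      ∑ x, if G.edge i x = G.edge j x then (1 / 2 : ℚ) else 1 / 4 := by
  rw [orbits, Set.image_pair]
  exact orbitCount_pair_eq_sum (G.edge_edge i) (G.edge_edge j) (G.edge_ne i) (G.edge_ne j)
    (h.edge_comm i j)

theorem degree_eq [Finite V] {G : TensorGraph V} (hv : G.IsVacuum) (hq : G.IsQuartic) :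
    G.degree = 3 + (G.pairSum : ℚ) / 2 - G.faceSum := by
  classical
  have : Fintype V := Fintype.ofFinite V
  have hL : (2 * G.numLines : ℚ) = Fintype.card V := by
    rw [← Nat.card_eq_fintype_card]
    exact_mod_cast two_mul_numLines hv
  have hL' : (G.numLines : ℚ) = ∑ x : V, (1 / 2 : ℚ) := by
    simp only [Finset.sum_const, nsmul_eq_mul, Finset.card_univ]
    linarith
  -- Both sides are sums over nodes: a tetrahedron node contributes 3/8 to each, a pillow node 1/2.
  have key : (3 / 2 * G.numLines : ℚ) - (3 / 2 * G.numTetra + G.numPillow) = G.pairSum / 2 := by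
    rw [pairSum]
    push_cast
    rw [orbits_some_pair hq, orbits_some_pair hq, orbits_some_pair hq, numTetra, numPillow,
      card_bubble_eq_sum hq, card_bubble_eq_sum hq, hL']
    simp only [Finset.mul_sum, ← Finset.sum_add_distrib, ← Finset.sum_sub_distrib,
      Finset.sum_div, hasKind_mk_iff]
    refine Finset.sum_congr rfl fun x _ => ?_
    obtain ⟨b, hb⟩ := isQuartic_iff.1 hq x
    have h01 : (0 : Fin 3) ≠ 1 := by decide
    have h02 : (0 : Fin 3) ≠ 2 := by decide
    have h12 : (1 : Fin 3) ≠ 2 := by decide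
    cases b with
    | tetra =>
      simp only [hb.edge_eq_iff_tetra, hb, if_true, not_kindAt_pillow_of_tetra hb, exists_false,
        if_false, h01, h02, h12]
      norm_num
    | pillow ℓ =>
      have h1 : ¬ G.KindAt .tetra x := fun h => not_kindAt_pillow_of_tetra h ℓ hb
      have h2 : ∃ ℓ, G.KindAt (.pillow ℓ) x := ⟨ℓ, hb⟩
      simp only [hb.edge_eq_iff_pillow, h1, h2, if_true, if_false]
      have hℓ : ℓ = 0 ∨ ℓ = 1 ∨ ℓ = 2 := by fin_cases ℓ <;> simp
      rcases hℓ with rfl | rfl | rfl <;>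
        simp only [h01, h02, h12, h01.symm, h02.symm, h12.symm, if_true, if_false, iff_self,
          iff_true, iff_false, not_true] <;> norm_num
  rw [degree, numFaces_eq]
  linarith

/-- The bound on the number of faces of a graph which may be disconnected. -/
theorem two_mul_faceSum_le [Finite V] {G : TensorGraph V} (hv : G.IsVacuum) (hq : G.IsQuartic) :
    2 * G.faceSum ≤ 6 * G.orbits Set.univ + G.pairSum := by
  have hcard := card_eq_four_mul hq
  -- Euler's inequality with every component allowed to be orientable; half the number of nodes is
  -- twice the number of bubbles.
  have key : ∀ i j, G.orbits {none, some i} + G.orbits {none, some j} +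
      G.orbits {some i, some j} ≤
      2 * G.orbits {some 0, some 1, some 2} + 2 * G.orbits {none, some i, some j} := by
    intro i j
    have h1 := orbitCount_euler (α := G.line) (β := G.edge i) (γ := G.edge j) G.line_line
      (G.edge_edge i) (G.edge_edge j) hv (G.edge_ne i) (G.edge_ne j)
    have h2 := finrank_antiFun_le {G.line, G.edge i, G.edge j}
    simp only [orbits, Set.image_insert_eq, Set.image_singleton, col] at hcard ⊢
    omega
  -- Submodularity trades components of the surfaces for components of the graph; the bubble counts
  -- cancel against those in `key`.
  have sub : ∀ i j, G.orbits {none, some i, some j} + G.orbits {some 0, some 1, some 2} ≤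
      G.orbits Set.univ + G.orbits {some i, some j} := by
    intro i j
    have h1 := orbitCount_submodular (G.col '' {none, some i, some j})
      (G.col '' {some 0, some 1, some 2})
    have h2 : G.col '' {none, some i, some j} ∪ G.col '' {some 0, some 1, some 2} =
        G.col '' Set.univ := by
      rw [← Set.image_union]
      congr 1
      ext c
      rcases c with _ | c
      · simp
      · fin_cases c <;> simp
    have h3 : G.col '' {some i, some j} ⊆
        G.col '' {none, some i, some j} ∩ G.col '' {some 0, some 1, some 2} := by
      refine Set.subset_inter (Set.image_mono (by grind)) (Set.image_mono ?_)
      rintro _ (rfl | rfl)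
      · fin_cases i <;> simp
      · fin_cases j <;> simp
    have h4 := orbitCount_anti h3
    rw [h2] at h1
    simp only [orbits]
    omega
  have k1 := key 0 1
  have k2 := key 0 2
  have k3 := key 1 2
  have s1 := sub 0 1
  have s2 := sub 0 2
  have s3 := sub 1 2
  rw [faceSum, pairSum]
  omega

theorem connected_iff [Finite V] {G : TensorGraph V} : G.Connected ↔ G.orbits Set.univ = 1 := by
  have hr : ∀ p q, (q = G.line p ∨ ∃ ℓ, q = G.edge ℓ p) ↔ ∃ f ∈ G.col '' Set.univ, q = f p := by
    intro p q
    simp [Option.exists, col]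
  rw [orbits, ← card_quot_eq_orbitCount _ _ hr, Nat.card_eq_one_iff_unique, Connected]
  constructor
  · rintro ⟨⟨x⟩, h⟩
    refine ⟨⟨fun a b => ?_⟩, ⟨Quot.mk _ x⟩⟩
    obtain ⟨a, rfl⟩ := Quot.exists_rep a
    obtain ⟨b, rfl⟩ := Quot.exists_rep b
    exact Quot.eqvGen_sound (h a b)
  · rintro ⟨h, ⟨x⟩⟩
    obtain ⟨x, rfl⟩ := Quot.exists_rep x
    exact ⟨⟨x⟩, fun a b => Quot.eqvGen_exact (h.elim _ _)⟩

/-- The leading order graphs, in terms of orbit counts. -/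
structure IsExtremal (G : TensorGraph V) : Prop where
  vacuum : G.IsVacuum
  quartic : G.IsQuartic
  orbits_univ : G.orbits Set.univ = 1
  two_mul_faceSum : 2 * G.faceSum = 6 + G.pairSum

theorem isLeadingOrder_iff [Finite V] {G : TensorGraph V} : G.IsLeadingOrder ↔ G.IsExtremal := by
  constructor
  · rintro ⟨hv, hc, hq, hd⟩
    refine ⟨hv, hq, connected_iff.1 hc, ?_⟩
    rw [degree_eq hv hq] at hd
    have : (2 * G.faceSum : ℚ) = 6 + G.pairSum := by linarith
    exact_mod_cast this
  · rintro ⟨hv, hq, hc, hd⟩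
    refine ⟨hv, connected_iff.2 hc, hq, ?_⟩
    rw [degree_eq hv hq]
    have : (2 * G.faceSum : ℚ) = 6 + G.pairSum := by exact_mod_cast hd
    linarith

end TensorGraph

/-! ### Isomorphisms, disjoint unions and restrictions -/

theorem orbitCount_congr {V : Type u} {W : Type v} {ι : Type*} (e : V ≃ W) {F : ι → V → V}
    {F' : ι → W → W} (h : ∀ i x, e (F i x) = F' i (e x)) (A : Set ι) :
    orbitCount (F '' A) = orbitCount (F' '' A) := by
  let L : invariantFun (F' '' A) ≃ₗ[ℚ] invariantFun (F '' A) :=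
    { toFun := fun φ => ⟨φ.1 ∘ e, by
        rintro _ ⟨i, hi, rfl⟩ x
        simpa [h] using φ.2 _ ⟨i, hi, rfl⟩ (e x)⟩
      invFun := fun φ => ⟨φ.1 ∘ e.symm, by
        rintro _ ⟨i, hi, rfl⟩ x
        have h1 := φ.2 _ ⟨i, hi, rfl⟩ (e.symm x)
        have h2 : e.symm (F' i x) = F i (e.symm x) := by simp [Equiv.symm_apply_eq, h]
        simpa [h2] using h1⟩
      map_add' := fun _ _ => rfl
      map_smul' := fun _ _ => rfl
      left_inv := fun φ => by ext; simp
      right_inv := fun φ => by ext; simp }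
  exact L.finrank_eq.symm

theorem orbitCount_sum {V : Type u} {W : Type v} [Finite V] [Finite W] {ι : Type*}
    (F : ι → V → V) (F' : ι → W → W) (A : Set ι) :
    orbitCount ((fun i => Sum.map (F i) (F' i)) '' A) =
      orbitCount (F '' A) + orbitCount (F' '' A) := by
  let L : invariantFun ((fun i => Sum.map (F i) (F' i)) '' A) ≃ₗ[ℚ]
      invariantFun (F '' A) × invariantFun (F' '' A) :=
    { toFun := fun φ => (⟨φ.1 ∘ Sum.inl, by
        rintro _ ⟨i, hi, rfl⟩ x
        exact φ.2 _ ⟨i, hi, rfl⟩ (Sum.inl x)⟩, ⟨φ.1 ∘ Sum.inr, by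
        rintro _ ⟨i, hi, rfl⟩ x
        exact φ.2 _ ⟨i, hi, rfl⟩ (Sum.inr x)⟩)
      invFun := fun φ => ⟨Sum.elim φ.1.1 φ.2.1, by
        rintro _ ⟨i, hi, rfl⟩ (x | x)
        · exact φ.1.2 _ ⟨i, hi, rfl⟩ x
        · exact φ.2.2 _ ⟨i, hi, rfl⟩ x⟩
      map_add' := fun _ _ => rfl
      map_smul' := fun _ _ => rfl
      left_inv := fun φ => by ext (x | x) <;> rfl
      right_inv := fun φ => rfl }
  rw [orbitCount, L.finrank_eq, Module.finrank_prod]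
  rfl

namespace TensorGraph

variable {V : Type u} {W : Type v}

theorem Iso.map_col {G : TensorGraph V} {H : TensorGraph W} (e : G.Iso H) (c : Option (Fin 3))
    (x : V) : e.toEquiv (G.col c x) = H.col c (e.toEquiv x) := by
  cases c
  · exact e.map_line x
  · exact e.map_edge _ x

theorem Iso.orbits_eq {G : TensorGraph V} {H : TensorGraph W} (e : G.Iso H)
    (A : Set (Option (Fin 3))) : G.orbits A = H.orbits A :=
  orbitCount_congr e.toEquiv e.map_col A

def Iso.symm {G : TensorGraph V} {H : TensorGraph W} (e : G.Iso H) : H.Iso G where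
  toEquiv := e.toEquiv.symm
  map_edge ℓ x := by simp [Equiv.symm_apply_eq, e.map_edge]
  map_line x := by simp [Equiv.symm_apply_eq, e.map_line]

theorem IsExtremal.of_iso {G : TensorGraph V} {H : TensorGraph W} (e : G.Iso H)
    (h : H.IsExtremal) : G.IsExtremal := by
  refine ⟨fun x hx => h.vacuum (e.toEquiv x) ?_, isQuartic_iff.2 fun x => ?_, ?_, ?_⟩
  · rw [← e.map_line, hx]
  · obtain ⟨b, hb⟩ := isQuartic_iff.1 h.quartic (e.toEquiv x)
    exact ⟨b, hb.of_map e.toEquiv.injective e.map_edge⟩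
  · rw [e.orbits_eq, h.orbits_univ]
  · have := h.two_mul_faceSum
    simpa only [faceSum, pairSum, e.orbits_eq] using this

/-- The disjoint union of two graphs. -/
def disjointSum (G : TensorGraph V) (H : TensorGraph W) : TensorGraph (V ⊕ W) where
  edge ℓ := Sum.map (G.edge ℓ) (H.edge ℓ)
  edge_edge ℓ y := by cases y <;> simp [G.edge_edge, H.edge_edge]
  edge_ne ℓ y := by cases y <;> simp [G.edge_ne, H.edge_ne]
  line := Sum.map G.line H.line
  line_line y := by cases y <;> simp [G.line_line, H.line_line]

theorem disjointSum_col (G : TensorGraph V) (H : TensorGraph W) :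
    (G.disjointSum H).col = fun c => Sum.map (G.col c) (H.col c) := by
  funext c
  cases c <;> rfl

theorem orbits_disjointSum [Finite V] [Finite W] (G : TensorGraph V) (H : TensorGraph W)
    (A : Set (Option (Fin 3))) : (G.disjointSum H).orbits A = G.orbits A + H.orbits A := by
  rw [orbits, disjointSum_col, orbitCount_sum]
  rfl

theorem faceSum_disjointSum [Finite V] [Finite W] (G : TensorGraph V) (H : TensorGraph W) :
    (G.disjointSum H).faceSum = G.faceSum + H.faceSum := by
  simp only [faceSum, orbits_disjointSum]
  omega

theorem pairSum_disjointSum [Finite V] [Finite W] (G : TensorGraph V) (H : TensorGraph W) :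
    (G.disjointSum H).pairSum = G.pairSum + H.pairSum := by
  simp only [pairSum, orbits_disjointSum]
  omega

/-- The restriction of a graph to a union of components. -/
def restrict (G : TensorGraph V) (S : Set V) (h : ∀ c, ∀ v ∈ S, G.col c v ∈ S) :
    TensorGraph S where
  edge ℓ v := ⟨G.edge ℓ v, h (some ℓ) v v.2⟩
  edge_edge ℓ v := Subtype.ext (G.edge_edge ℓ v)
  edge_ne ℓ v hv := G.edge_ne ℓ v (congrArg Subtype.val hv)
  line v := ⟨G.line v, h none v v.2⟩
  line_line v := Subtype.ext (G.line_line v)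

theorem col_mem_compl {G : TensorGraph V} {S : Set V} (h : ∀ c, ∀ v ∈ S, G.col c v ∈ S) :
    ∀ c, ∀ v ∈ Sᶜ, G.col c v ∈ Sᶜ := by
  intro c v hv hc
  have := h c _ hc
  rw [col_col] at this
  exact hv this

open Classical in
/-- A graph is the disjoint union of a union of components and of the remaining components. -/
noncomputable def restrictSumIso (G : TensorGraph V) (S : Set V)
    (h : ∀ c, ∀ v ∈ S, G.col c v ∈ S) :
    ((G.restrict S h).disjointSum (G.restrict Sᶜ (col_mem_compl h))).Iso G where
  toEquiv := Equiv.Set.sumCompl S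
  map_edge ℓ x := by cases x <;> simp [disjointSum, restrict]
  map_line x := by cases x <;> simp [disjointSum, restrict]

theorem restrict_isVacuum {G : TensorGraph V} {S : Set V} (h : ∀ c, ∀ v ∈ S, G.col c v ∈ S)
    (hG : G.IsVacuum) : (G.restrict S h).IsVacuum :=
  fun v hv => hG v (congrArg Subtype.val hv)

theorem restrict_isQuartic {G : TensorGraph V} {S : Set V} (h : ∀ c, ∀ v ∈ S, G.col c v ∈ S)
    (hG : G.IsQuartic) : (G.restrict S h).IsQuartic :=
  isQuartic_iff.2 fun v => (isQuartic_iff.1 hG v).imp fun _ hb =>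
    hb.of_map Subtype.val_injective fun _ _ => rfl

theorem isQuartic_of_edge_eq {M N : TensorGraph V} (he : N.edge = M.edge) (h : N.IsQuartic) : M.IsQuartic :=
  isQuartic_iff.2 fun v => (isQuartic_iff.1 h v).imp fun _ hb =>
    hb.of_map Function.injective_id fun _ _ => by simp [he]

/-! ### Switching two lines -/

/-- `H'` arises from `H` by replacing the lines at the nodes `p` and `q` by a line which joins `p`
to `q` and a line which joins the former neighbours of `p` and `q`. -/
structure IsSwitch (H H' : TensorGraph V) (p q : V) : Prop where
  ne : p ≠ q
  edge_eq : H'.edge = H.edge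
  line_left : H'.line p = q
  line_right : H'.line (H.line p) = H.line q
  line_eq : ∀ v, v ≠ p → v ≠ q → v ≠ H.line p → v ≠ H.line q → H'.line v = H.line v

namespace IsSwitch

variable {H H' : TensorGraph V} {p q : V}

theorem line_left' (h : IsSwitch H H' p q) : H'.line q = p := by
  rw [← h.line_left, H'.line_line]

theorem line_right' (h : IsSwitch H H' p q) : H'.line (H.line q) = H.line p := by
  rw [← h.line_right, H'.line_line]

theorem isVacuum (h : IsSwitch H H' p q) (hH : H.IsVacuum) : H'.IsVacuum := by
  intro v hv
  have h1 := h.ne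
  have h2 := h.line_left
  have h3 := h.line_left'
  have h4 := h.line_right
  have h5 := h.line_right'
  have h6 := h.line_eq v
  have h7 := H.line_line p
  have h8 := H.line_line q
  have h9 := hH v
  by_cases c1 : v = p <;> by_cases c2 : v = q <;> by_cases c3 : v = H.line p <;>
    by_cases c4 : v = H.line q <;> grind

theorem isQuartic (h : IsSwitch H H' p q) (hH : H.IsQuartic) : H'.IsQuartic :=
  isQuartic_of_edge_eq h.edge_eq.symm hH

theorem pairSum_eq (h : IsSwitch H H' p q) : H'.pairSum = H.pairSum := by
  simp only [pairSum, orbits, Set.image_insert_eq, Set.image_singleton, col, h.edge_eq]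

/-- Once `φ` agrees at `p` and `q`, it agrees at all four ends of the switched lines, so the new
lines preserve it. `mem_of_mem'` is the same argument backwards. -/
theorem mem_of_mem (h : IsSwitch H H' p q) {A : Set (Option (Fin 3))} {φ : V → ℚ}
    (hφ : φ ∈ invariantFun (H.col '' A)) (hpq : none ∈ A → φ p = φ q) :
    φ ∈ invariantFun (H'.col '' A) := by
  rintro _ ⟨c, hc, rfl⟩ v
  cases c with
  | some ℓ =>
    have := hφ _ ⟨_, hc, rfl⟩ v
    simpa [col, h.edge_eq] using this
  | none =>
    have h1 := h.line_left
    have h2 := h.line_left'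
    have h3 := h.line_right
    have h4 := h.line_right'
    have h5 := h.line_eq v
    have h6 : ∀ v, φ (H.line v) = φ v := hφ _ ⟨_, hc, rfl⟩
    have h7 := hpq hc
    have h8 := h6 v
    have h9 := h6 p
    have h10 := h6 q
    change φ (H'.line v) = φ v
    clear h6
    by_cases c1 : v = p <;> by_cases c2 : v = q <;> by_cases c3 : v = H.line p <;>
      by_cases c4 : v = H.line q <;> grind

theorem mem_of_mem' (h : IsSwitch H H' p q) {A : Set (Option (Fin 3))} {φ : V → ℚ}
    (hφ : φ ∈ invariantFun (H'.col '' A)) (hpq : none ∈ A → φ p = φ (H.line p)) :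
    φ ∈ invariantFun (H.col '' A) := by
  rintro _ ⟨c, hc, rfl⟩ v
  cases c with
  | some ℓ =>
    have := hφ _ ⟨_, hc, rfl⟩ v
    simpa [col, h.edge_eq] using this
  | none =>
    have h1 := h.line_left
    have h3 := h.line_right
    have h5 := h.line_eq v
    have h6 : ∀ v, φ (H'.line v) = φ v := hφ _ ⟨_, hc, rfl⟩
    have h7 := hpq hc
    have h8 := h6 v
    have h9 := h6 p
    have h10 := h6 (H.line p)
    have h11 := H.line_line p
    have h12 := H.line_line q
    change φ (H.line v) = φ v
    clear h6
    by_cases c1 : v = p <;> by_cases c2 : v = q <;> by_cases c3 : v = H.line p <;>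
      by_cases c4 : v = H.line q <;> grind

theorem orbits_le [Finite V] (h : IsSwitch H H' p q) (A : Set (Option (Fin 3))) :
    H.orbits A ≤ H'.orbits A + 1 := by
  refine (finrank_le_finrank_inf_ker_add_one _ p q).trans (Nat.add_le_add_right ?_ 1)
  exact Submodule.finrank_mono fun φ hφ => h.mem_of_mem hφ.1 fun _ => mem_ker_valueDiff.1 hφ.2

/-- If the two switched lines form a cut of the subgraph formed by the colours in `A`, the number of
its components increases by one. -/
theorem orbits_eq [Finite V] (h : IsSwitch H H' p q) (hH : H.IsVacuum)
    {A : Set (Option (Fin 3))} (h0 : none ∈ A) {ℓ : Fin 3} (hℓ : some ℓ ∈ A) {Z : Set V}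
    (hZ : ∀ c ∈ A, ∀ v ∈ Z, H'.col c v ∈ Z) (hp : p ∈ Z) (hx : H.line p ∉ Z) :
    H'.orbits A = H.orbits A + 1 := by
  classical
  -- A cycle of lines and colour `ℓ` that leaves `Z` through `p` must return through `q`.
  have key : ∀ φ ∈ invariantFun (H.col '' A), φ p = φ q := by
    intro φ hφ
    refine eq_of_invariantFun_of_cut (l := H.line) (g := H.edge ℓ) (Z := Z) H.line_line hH
      (H.edge_edge ℓ) (H.edge_ne ℓ) ?_ ?_ hp hx ?_
    · intro v hv
      have := hZ _ hℓ v hv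
      simpa [col, h.edge_eq] using this
    · intro v hv hvp hvq
      rw [← h.line_eq v hvp hvq]
      · exact hZ _ h0 v hv
      · rintro rfl
        exact hx hv
      · rintro rfl
        have : H'.line (H.line q) ∈ Z := hZ _ h0 _ hv
        rw [h.line_right'] at this
        exact hx this
    · refine invariantFun_anti ?_ hφ
      rintro _ (rfl | rfl)
      · exact ⟨none, h0, rfl⟩
      · exact ⟨some ℓ, hℓ, rfl⟩
  refine le_antisymm ?_ ?_
  · refine (finrank_le_finrank_inf_ker_add_one _ p (H.line p)).trans (Nat.add_le_add_right ?_ 1)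
    exact Submodule.finrank_mono fun φ hφ =>
      h.mem_of_mem' hφ.1 fun _ => mem_ker_valueDiff.1 hφ.2
  · refine Submodule.finrank_lt_finrank_of_lt (lt_of_le_of_ne
      (fun φ hφ => h.mem_of_mem hφ fun _ => key φ hφ) fun heq => ?_)
    -- The indicator of `Z` makes the inclusion strict: in `H` the line at `p` leaves `Z`.
    have h1 : (fun v => if v ∈ Z then (1 : ℚ) else 0) ∈ invariantFun (H'.col '' A) := by
      rintro _ ⟨c, hc, rfl⟩ v
      have : H'.col c v ∈ Z ↔ v ∈ Z :=
        ⟨fun hv => by simpa [col_col] using hZ c hc _ hv, hZ c hc v⟩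
      simp [this]
    rw [← heq] at h1
    have h2 := h1 _ ⟨none, h0, rfl⟩ p
    simp [col, hx, hp] at h2

end IsSwitch

open Classical in
/-- The graph obtained by switching the lines at the nodes `p` and `q`. -/
noncomputable def switch (H : TensorGraph V) (hH : H.IsVacuum) (p q : V) (hpq : p ≠ q) (hq : q ≠ H.line p) :
    TensorGraph V where
  edge := H.edge
  edge_edge := H.edge_edge
  edge_ne := H.edge_ne
  line v := if v = p then q else if v = q then p else if v = H.line p then H.line q else
    if v = H.line q then H.line p else H.line v
  line_line v := by
    have h1 := H.line_line p
    have h2 := H.line_line q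
    have h3 := H.line_line v
    have h4 := hH p
    have h5 := hH q
    grind

theorem switch_isSwitch (H : TensorGraph V) (hH : H.IsVacuum) (p q : V) (hpq : p ≠ q)
    (hq : q ≠ H.line p) : IsSwitch H (H.switch hH p q hpq hq) p q := by
  have h1 := hH p
  refine ⟨hpq, rfl, by simp [switch], ?_, ?_⟩
  · simp [switch, h1, hq.symm]
  · intro v h1 h2 h3 h4
    simp [switch, h1, h2, h3, h4]

/-! ### Extremality under insertion and cutting -/

section Insertion

variable {G : TensorGraph V} {M N : TensorGraph W} {a b : W}

/-- Insertion is undone by a switch at the two legs, which restores `G` next to the closure `N` of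
`M`; this reduces insertion to the count for cuts. -/
theorem insertAt_isSwitch {x : V} (hx : G.line x ≠ x) (hM : M.IsTwoPoint a b)
    (he : N.edge = M.edge) (hab : N.line a = b)
    (hl : ∀ w, w ≠ a → w ≠ b → N.line w = M.line w) :
    IsSwitch (G.insertAt x hx M a b hM) (G.disjointSum N) (Sum.inr a) (Sum.inr b) := by
  have hab' := hM.1
  have h1 : (G.insertAt x hx M a b hM).line (Sum.inr a) = Sum.inl x := by simp [insertAt]
  have h2 : (G.insertAt x hx M a b hM).line (Sum.inr b) = Sum.inl (G.line x) := by
    simp [insertAt, hab'.symm]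
  refine ⟨by simpa using hab', by simp [insertAt, disjointSum, he], by simp [disjointSum, hab],
    by rw [h1, h2]; rfl, ?_⟩
  rw [h1, h2]
  rintro (v | w) h3 h4 h5 h6
  · have h5' : v ≠ x := by simpa using h5
    have h6' : v ≠ G.line x := by simpa using h6
    simp [disjointSum, insertAt, h5', h6']
  · have h5' : w ≠ a := by simpa using h3
    have h6' : w ≠ b := by simpa using h4
    simp [disjointSum, insertAt, h5', h6', hl]

theorem insertAt_isVacuum {x : V} (hx : G.line x ≠ x) (hM : M.IsTwoPoint a b)
    (h : G.IsVacuum) : (G.insertAt x hx M a b hM).IsVacuum := by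
  rintro (v | w) hv
  · have h1 := h v
    simp only [insertAt, Sum.elim_inl] at hv
    grind
  · have h1 := hM.2 w
    simp only [insertAt, Sum.elim_inr] at hv
    grind

theorem insertAt_isQuartic {x : V} (hx : G.line x ≠ x) (hM : M.IsTwoPoint a b)
    (hG : G.IsQuartic) (hM' : M.IsQuartic) : (G.insertAt x hx M a b hM).IsQuartic := by
  rw [isQuartic_iff] at hG hM' ⊢
  rintro (v | w)
  · exact (hG v).imp fun _ hb => hb.map Sum.inl_injective fun _ _ => rfl
  · exact (hM' w).imp fun _ hb => hb.map Sum.inr_injective fun _ _ => rfl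

/-- Insertion of a two-point graph with an extremal closure preserves extremality. -/
theorem insertAt_isExtremal [Finite V] [Finite W] {x : V} (hx : G.line x ≠ x)
    (hM : M.IsTwoPoint a b) (hN : N.IsExtremal) (he : N.edge = M.edge) (hab : N.line a = b)
    (hl : ∀ w, w ≠ a → w ≠ b → N.line w = M.line w) (hG : G.IsExtremal) :
    (G.insertAt x hx M a b hM).IsExtremal := by
  have hs := insertAt_isSwitch hx hM he hab hl
  have hvac := insertAt_isVacuum hx hM hG.vacuum
  have key : ∀ A : Set (Option (Fin 3)), none ∈ A → (∃ ℓ, some ℓ ∈ A) →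
      G.orbits A + N.orbits A = (G.insertAt x hx M a b hM).orbits A + 1 := by
    rintro A h0 ⟨ℓ, hℓ⟩
    rw [← orbits_disjointSum]
    refine hs.orbits_eq hvac h0 hℓ (Z := Set.range Sum.inr) ?_ ⟨a, rfl⟩ (by simp [insertAt])
    rintro c - _ ⟨w, rfl⟩
    exact ⟨N.col c w, by simp [disjointSum_col]⟩
  have hpair : G.pairSum + N.pairSum = (G.insertAt x hx M a b hM).pairSum := by
    rw [← pairSum_disjointSum, hs.pairSum_eq]
  have hNu := hN.orbits_univ
  have hNf := hN.two_mul_faceSum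
  have hGu := hG.orbits_univ
  have hGf := hG.two_mul_faceSum
  have h1 := key Set.univ trivial ⟨0, trivial⟩
  have h2 := key {none, some 0} (by simp) ⟨0, by simp⟩
  have h3 := key {none, some 1} (by simp) ⟨1, by simp⟩
  have h4 := key {none, some 2} (by simp) ⟨2, by simp⟩
  refine ⟨hvac, insertAt_isQuartic hx hM hG.quartic (isQuartic_of_edge_eq he hN.quartic),
    by omega, ?_⟩
  rw [faceSum] at hNf hGf ⊢
  omega

end Insertion

/-- Cutting an extremal graph along two lines leaves two extremal graphs. -/
theorem IsSwitch.restrict_isExtremal [Finite V] {H H' : TensorGraph V} {p q : V}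
    (h : IsSwitch H H' p q) (hH : H.IsExtremal) {S : Set V}
    (hS : ∀ c, ∀ v ∈ S, H'.col c v ∈ S) (hp : p ∈ S) (hx : H.line p ∉ S) :
    (H'.restrict Sᶜ (col_mem_compl hS)).IsExtremal := by
  have hv := h.isVacuum hH.vacuum
  have hq := h.isQuartic hH.quartic
  have key : ∀ A : Set (Option (Fin 3)), none ∈ A → (∃ ℓ, some ℓ ∈ A) →
      H'.orbits A = H.orbits A + 1 := by
    rintro A h0 ⟨ℓ, hℓ⟩
    exact h.orbits_eq hH.vacuum h0 hℓ (fun c _ => hS c) hp hx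
  have h1 := key Set.univ trivial ⟨0, trivial⟩
  have h2 := key {none, some 0} (by simp) ⟨0, by simp⟩
  have h3 := key {none, some 1} (by simp) ⟨1, by simp⟩
  have h4 := key {none, some 2} (by simp) ⟨2, by simp⟩
  have hF : H'.faceSum = H.faceSum + 3 := by
    rw [faceSum, faceSum]
    omega
  have hP := h.pairSum_eq
  have e := restrictSumIso H' S hS
  have h1' := e.orbits_eq Set.univ
  have hF' : (H'.restrict S hS).faceSum + (H'.restrict Sᶜ (col_mem_compl hS)).faceSum =
      H'.faceSum := by
    rw [← faceSum_disjointSum]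
    simp only [faceSum, e.orbits_eq]
  have hP' : (H'.restrict S hS).pairSum + (H'.restrict Sᶜ (col_mem_compl hS)).pairSum =
      H'.pairSum := by
    rw [← pairSum_disjointSum]
    simp only [pairSum, e.orbits_eq]
  rw [orbits_disjointSum] at h1'
  -- The cut leaves two non-empty parts with two components in all, so each is connected. Their face
  -- bounds add up to the known total, so both are equalities.
  have b1 := two_mul_faceSum_le (restrict_isVacuum hS hv) (restrict_isQuartic hS hq)
  have b2 := two_mul_faceSum_le (restrict_isVacuum (col_mem_compl hS) hv)
    (restrict_isQuartic (col_mem_compl hS) hq)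
  have : Nonempty S := ⟨⟨p, hp⟩⟩
  have : Nonempty (Sᶜ : Set V) := ⟨⟨H.line p, hx⟩⟩
  have p1 : 0 < (H'.restrict S hS).orbits Set.univ := orbitCount_pos _
  have p2 : 0 < (H'.restrict Sᶜ (col_mem_compl hS)).orbits Set.univ := orbitCount_pos _
  have hHu := hH.orbits_univ
  have hHf := hH.two_mul_faceSum
  exact ⟨restrict_isVacuum _ hv, restrict_isQuartic _ hq, by omega, by omega⟩

end TensorGraph

/-! ### Melonic graphs are extremal and contain melons -/

namespace TensorGraph

variable {V : Type u} {W : Type v}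

theorem baseI_kindAt (x : Bool × Corner) : baseI.KindAt .tetra x :=
  ⟨fun k => (x.1, BubbleKind.translate x.2 k), fun _ _ h =>
    BubbleKind.translate_injective x.2 (congrArg Prod.snd h),
    by simp only [BubbleKind.translate_false],
    fun ℓ k => by simp [baseI, BubbleKind.edge_translate]⟩

theorem baseII_kindAt (ℓ : Fin 3) (x : Corner) : (baseII ℓ).KindAt (.pillow ℓ) x :=
  ⟨BubbleKind.translate x, BubbleKind.translate_injective x, BubbleKind.translate_false x,
    fun i k => (BubbleKind.edge_translate _ i x k).symm⟩

theorem baseI_isExtremal : baseI.IsExtremal := by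
  classical
  have hv : baseI.IsVacuum := fun x h => by simpa [baseI] using congrArg Prod.fst h
  have hq : baseI.IsQuartic := isQuartic_iff.2 fun x => ⟨_, baseI_kindAt x⟩
  refine ⟨hv, hq, ?_, ?_⟩
  · refine (orbitCount_eq_one_iff _).2 fun φ hφ => ?_
    have key : ∀ x, φ x = φ (false, false, false) := by
      have h1 : ∀ k, φ (false, k) = φ (false, false, false) :=
        mem_of_corner (G := baseI) (b := .tetra) (f := fun k => (false, k)) (fun _ _ => rfl)
          (s := {v | φ v = φ (false, false, false)})
          (fun ℓ v hv => (hφ _ ⟨some ℓ, trivial, rfl⟩ v).trans hv) rfl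
      rintro ⟨s, k⟩
      cases s
      · exact h1 k
      · exact (hφ _ ⟨none, trivial, rfl⟩ (false, k)).trans (h1 k)
    exact fun x y => (key x).trans (key y).symm
  · have hl : ∀ ℓ, baseI.orbits {none, some ℓ} = 2 := by
      intro ℓ
      have h1 := orbitCount_pair_eq_sum baseI.line_line (baseI.edge_edge ℓ) hv (baseI.edge_ne ℓ)
        (fun _ => rfl)
      have h2 : ∀ x, baseI.line x ≠ baseI.edge ℓ x :=
        fun x h => by simpa [baseI] using congrArg Prod.fst h
      simp only [h2, if_false, Finset.sum_const, Finset.card_univ, nsmul_eq_mul,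
        Fintype.card_prod, Fintype.card_bool] at h1
      rw [orbits, Set.image_pair]
      have : (orbitCount {baseI.line, baseI.edge ℓ} : ℚ) = (2 : ℕ) := by rw [h1]; norm_num
      exact_mod_cast this
    have he : ∀ i j, i ≠ j → baseI.orbits {some i, some j} = 2 := by
      intro i j hij
      have h1 := orbits_some_pair hq i j
      simp only [fun x => (baseI_kindAt x).edge_eq_iff_tetra i j, hij, if_false, Finset.sum_const,
        Finset.card_univ, nsmul_eq_mul, Fintype.card_prod, Fintype.card_bool] at h1
      have : (baseI.orbits {some i, some j} : ℚ) = (2 : ℕ) := by rw [h1]; norm_num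
      exact_mod_cast this
    rw [faceSum, pairSum, hl, hl, hl, he 0 1 (by decide), he 0 2 (by decide),
      he 1 2 (by decide)]

theorem baseII_isExtremal (ℓ : Fin 3) : (baseII ℓ).IsExtremal := by
  classical
  have hv : (baseII ℓ).IsVacuum := fun x h => by simpa [baseII] using congrArg Prod.snd h
  have hq : (baseII ℓ).IsQuartic := isQuartic_iff.2 fun x => ⟨_, baseII_kindAt ℓ x⟩
  refine ⟨hv, hq, ?_, ?_⟩
  · refine (orbitCount_eq_one_iff _).2 fun φ hφ => ?_
    have key : ∀ x, φ x = φ (false, false) :=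
      mem_of_corner (G := baseII ℓ) (b := .pillow ℓ) (f := id) (fun _ _ => rfl)
        (s := {v | φ v = φ (false, false)})
        (fun i v hv => (hφ _ ⟨some i, trivial, rfl⟩ v).trans hv) rfl
    exact fun x y => (key x).trans (key y).symm
  · have hl : ∀ i, (baseII ℓ).orbits {none, some i} = if i = ℓ then 1 else 2 := by
      intro i
      have hc : ∀ x, (baseII ℓ).line ((baseII ℓ).edge i x) =
          (baseII ℓ).edge i ((baseII ℓ).line x) := by
        intro x
        by_cases h : i = ℓ <;> simp [baseII, BubbleKind.edge, h]
      have h1 := orbitCount_pair_eq_sum (baseII ℓ).line_line ((baseII ℓ).edge_edge i) hv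
        ((baseII ℓ).edge_ne i) hc
      have h2 : ∀ x, (baseII ℓ).line x = (baseII ℓ).edge i x ↔ i ≠ ℓ := by
        intro x
        by_cases h : i = ℓ <;> simp [baseII, BubbleKind.edge, h, Prod.ext_iff]
      simp only [h2, Finset.sum_const, Finset.card_univ, nsmul_eq_mul,
        Fintype.card_prod, Fintype.card_bool] at h1
      rw [orbits, Set.image_pair]
      have : (orbitCount {(baseII ℓ).line, (baseII ℓ).edge i} : ℚ) =
          ((if i = ℓ then 1 else 2 : ℕ) : ℚ) := by
        rw [h1]
        by_cases h : i = ℓ <;> (simp [h]; try norm_num)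
      exact_mod_cast this
    have he : ∀ i j, (baseII ℓ).orbits {some i, some j} = if (i = ℓ ↔ j = ℓ) then 2 else 1 := by
      intro i j
      have h1 := orbits_some_pair hq i j
      simp only [fun x => (baseII_kindAt ℓ x).edge_eq_iff_pillow i j, Finset.sum_const,
        Finset.card_univ, nsmul_eq_mul, Fintype.card_prod, Fintype.card_bool] at h1
      have : ((baseII ℓ).orbits {some i, some j} : ℚ) =
          ((if (i = ℓ ↔ j = ℓ) then 2 else 1 : ℕ) : ℚ) := by
        rw [h1]
        split_ifs <;> norm_num
      exact_mod_cast this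
    rw [faceSum, pairSum, hl, hl, hl, he, he, he]
    fin_cases ℓ <;> decide

theorem melonI_line_ne_iff (w : Bool × Corner) :
    melonI.line w ≠ w ↔ w.2 ≠ (false, false) := by
  revert w
  decide

theorem melonII_line_ne_iff (ℓ : Fin 3) (w : Corner) :
    (melonII ℓ).line w ≠ w ↔ w.1 = true := by
  by_cases h : w.1 = false <;> simp [melonII, h, Prod.ext_iff]

theorem baseI_line_eq (w : Bool × Corner) (ha : w ≠ (false, false, false))
    (hb : w ≠ (true, false, false)) : baseI.line w = melonI.line w := by
  have h : w.2 ≠ (false, false) := by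
    obtain ⟨s, k⟩ := w
    rintro rfl
    cases s
    · exact ha rfl
    · exact hb rfl
  simp [baseI, melonI, h]

theorem baseII_line_eq (ℓ : Fin 3) (w : Corner) (ha : w ≠ (false, false))
    (hb : w ≠ (false, true)) : (baseII ℓ).line w = (melonII ℓ).line w := by
  have h : w.1 ≠ false := by
    obtain ⟨s, k⟩ := w
    rintro rfl
    cases k
    · exact ha rfl
    · exact hb rfl
  simp [baseII, melonII, h]

theorem IsMelonic.isExtremal {G : TensorGraph V} (h : G.IsMelonic) : Finite V ∧ G.IsExtremal := by
  induction h with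
  | baseI G h =>
    obtain ⟨e⟩ := h
    exact ⟨Finite.of_equiv _ e.toEquiv.symm, baseI_isExtremal.of_iso e⟩
  | baseII G ℓ h =>
    obtain ⟨e⟩ := h
    exact ⟨Finite.of_equiv _ e.toEquiv.symm, (baseII_isExtremal ℓ).of_iso e⟩
  | insertI G H x hx _ h ih =>
    obtain ⟨e⟩ := h
    obtain ⟨hf, ih⟩ := ih
    exact ⟨Finite.of_equiv _ e.toEquiv.symm, (insertAt_isExtremal hx melonI_isTwoPoint
      baseI_isExtremal rfl rfl baseI_line_eq ih).of_iso e⟩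
  | insertII G H x hx ℓ _ h ih =>
    obtain ⟨e⟩ := h
    obtain ⟨hf, ih⟩ := ih
    exact ⟨Finite.of_equiv _ e.toEquiv.symm, (insertAt_isExtremal hx (melonII_isTwoPoint ℓ)
      (baseII_isExtremal ℓ) rfl rfl (baseII_line_eq ℓ) ih).of_iso e⟩

/-- `G` contains the graph `M`, in such a way that the node `x` is not an end of one of the internal
lines of `M`. -/
def ContainsAvoiding (G : TensorGraph V) (M : TensorGraph W) (x : V) : Prop :=
  ∃ f : W → V, Function.Injective f ∧ (∀ ℓ w, f (M.edge ℓ w) = G.edge ℓ (f w)) ∧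
    (∀ w, M.line w ≠ w → f (M.line w) = G.line (f w)) ∧ ∀ w, M.line w ≠ w → f w ≠ x

/-- `G` contains an elementary melon. -/
def ContainsMelon (G : TensorGraph V) : Prop :=
  G.Contains melonI ∨ ∃ ℓ, G.Contains (melonII ℓ)

/-- `G` contains an elementary melon without an internal line at the node `x`. -/
def ContainsMelonAvoiding (G : TensorGraph V) (x : V) : Prop :=
  G.ContainsAvoiding melonI x ∨ ∃ ℓ, G.ContainsAvoiding (melonII ℓ) x

/-- A subgraph whose internal lines avoid the line at `x` persists if only the line at `x` is
changed. -/
theorem ContainsAvoiding.contains {U : Type*} {G : TensorGraph V} {M : TensorGraph W} {x : V}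
    {H : TensorGraph U} (h : G.ContainsAvoiding M x) {g : V → U} (hg : Function.Injective g)
    (he : ∀ ℓ v, g (G.edge ℓ v) = H.edge ℓ (g v))
    (hl : ∀ v, v ≠ x → v ≠ G.line x → g (G.line v) = H.line (g v)) (y : U)
    (hy : ∀ v, v ≠ x → v ≠ G.line x → g v ≠ y) : H.ContainsAvoiding M y := by
  obtain ⟨f, hf, hfe, hfl, hfx⟩ := h
  have hfx' : ∀ w, M.line w ≠ w → f w ≠ G.line x := by
    intro w hw h
    refine hfx (M.line w) ?_ ?_
    · rw [M.line_line]
      exact hw.symm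
    · rw [hfl w hw, h, G.line_line]
  refine ⟨g ∘ f, hg.comp hf, fun ℓ w => by simp [hfe, he], fun w hw => ?_, fun w hw => ?_⟩
  · simp [hfl w hw, hl _ (hfx w hw) (hfx' w hw)]
  · exact hy _ (hfx w hw) (hfx' w hw)

theorem ContainsMelonAvoiding.map {U : Type*} {G : TensorGraph V} {x : V}
    {H : TensorGraph U} (h : G.ContainsMelonAvoiding x) {g : V → U} (hg : Function.Injective g)
    (he : ∀ ℓ v, g (G.edge ℓ v) = H.edge ℓ (g v))
    (hl : ∀ v, v ≠ x → v ≠ G.line x → g (G.line v) = H.line (g v)) (y : U)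
    (hy : ∀ v, v ≠ x → v ≠ G.line x → g v ≠ y) : H.ContainsMelonAvoiding y :=
  h.imp (fun h => h.contains hg he hl y hy) fun ⟨ℓ, h⟩ => ⟨ℓ, h.contains hg he hl y hy⟩

theorem ContainsMelonAvoiding.containsMelon {G : TensorGraph V} {x : V}
    (h : G.ContainsMelonAvoiding x) : G.ContainsMelon :=
  h.imp (fun ⟨f, h1, h2, h3, _⟩ => ⟨f, h1, h2, h3⟩)
    fun ⟨ℓ, f, h1, h2, h3, _⟩ => ⟨ℓ, f, h1, h2, h3⟩

theorem ContainsMelonAvoiding.of_iso {G : TensorGraph V} {H : TensorGraph W} (e : G.Iso H)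
    {x : V} (h : H.ContainsMelonAvoiding (e.toEquiv x)) : G.ContainsMelonAvoiding x :=
  h.map (g := e.toEquiv.symm) e.toEquiv.symm.injective e.symm.map_edge
    (fun v _ _ => e.symm.map_line v) x fun v hv _ h => hv (by rw [← h, Equiv.apply_symm_apply])

/-- Translation symmetry lets any of the four lines be the one cut open. -/
theorem baseI_containsMelonAvoiding (x : Bool × Corner) : baseI.ContainsMelonAvoiding x := by
  refine Or.inl ⟨fun w => (w.1, BubbleKind.translate x.2 w.2), ?_, ?_, ?_, ?_⟩
  · rintro ⟨s, k⟩ ⟨s', k'⟩ h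
    obtain ⟨h1, h2⟩ := Prod.ext_iff.1 h
    exact Prod.ext h1 (BubbleKind.translate_injective _ h2)
  · intro ℓ w
    simp [melonI, baseI, BubbleKind.edge_translate]
  · intro w hw
    have := (melonI_line_ne_iff w).1 hw
    simp [melonI, baseI, this]
  · intro w hw h
    refine (melonI_line_ne_iff w).1 hw (BubbleKind.translate_injective x.2 ?_)
    rw [BubbleKind.translate_false]
    exact congrArg Prod.snd h

theorem baseII_containsMelonAvoiding (ℓ : Fin 3) (x : Corner) :
    (baseII ℓ).ContainsMelonAvoiding x := by
  -- This translation puts the legs on the double edge containing `x`, hence the internal line on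
  -- the other one.
  refine Or.inr ⟨ℓ, BubbleKind.translate (x.1, false), BubbleKind.translate_injective _, ?_, ?_,
    ?_⟩
  · intro i w
    exact (BubbleKind.edge_translate _ _ _ _).symm
  · intro w hw
    have := (melonII_line_ne_iff ℓ w).1 hw
    simp [melonII, baseII, BubbleKind.translate, this]
  · intro w hw h
    have := (melonII_line_ne_iff ℓ w).1 hw
    have h1 := congrArg Prod.fst h
    simp [BubbleKind.translate, this] at h1

theorem insertAt_containsAvoiding_inr {G : TensorGraph V} {M : TensorGraph W} {a b : W} {x : V}
    (hx : G.line x ≠ x) (hM : M.IsTwoPoint a b) (z : V ⊕ W)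
    (hz : ∀ w, M.line w ≠ w → Sum.inr w ≠ z) :
    (G.insertAt x hx M a b hM).ContainsAvoiding M z := by
  refine ⟨Sum.inr, Sum.inr_injective, fun _ _ => rfl, fun w hw => ?_, hz⟩
  have h1 : w ≠ a := fun h => hw ((hM.2 w).2 (Or.inl h))
  have h2 : w ≠ b := fun h => hw ((hM.2 w).2 (Or.inr h))
  simp [insertAt, h1, h2]

/-- The inserted melon serves unless `z` is on one of its internal lines. In that case an old melon
avoiding the cut line at `x` survives and is disjoint from `z`. -/
theorem insertAt_containsMelonAvoiding {G : TensorGraph V} {M : TensorGraph W} {a b : W} {x : V}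
    (hx : G.line x ≠ x) (hM : M.IsTwoPoint a b) (hG : G.ContainsMelonAvoiding x)
    (hm : (∀ z, (∀ w, M.line w ≠ w → Sum.inr w ≠ z) →
      (G.insertAt x hx M a b hM).ContainsMelonAvoiding z)) (z : V ⊕ W) :
    (G.insertAt x hx M a b hM).ContainsMelonAvoiding z := by
  by_cases hz : ∀ w, M.line w ≠ w → Sum.inr w ≠ z
  · exact hm z hz
  · push Not at hz
    obtain ⟨w, -, rfl⟩ := hz
    refine hG.map Sum.inl_injective (fun _ _ => rfl) (fun v h1 h2 => ?_) _ fun v _ _ => by simp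
    simp [insertAt, h1, h2]

theorem IsMelonic.containsMelonAvoiding {G : TensorGraph V} (h : G.IsMelonic) :
    ∀ x, G.ContainsMelonAvoiding x := by
  induction h with
  | baseI G h =>
    obtain ⟨e⟩ := h
    exact fun x => (baseI_containsMelonAvoiding _).of_iso e
  | baseII G ℓ h =>
    obtain ⟨e⟩ := h
    exact fun x => (baseII_containsMelonAvoiding ℓ _).of_iso e
  | insertI G H x hx _ h ih =>
    obtain ⟨e⟩ := h
    exact fun y => (insertAt_containsMelonAvoiding hx _ (ih x)
      (fun z hz => Or.inl (insertAt_containsAvoiding_inr hx _ z hz)) _).of_iso e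
  | insertII G H x hx ℓ _ h ih =>
    obtain ⟨e⟩ := h
    exact fun y => (insertAt_containsMelonAvoiding hx _ (ih x)
      (fun z hz => Or.inr ⟨ℓ, insertAt_containsAvoiding_inr hx _ z hz⟩) _).of_iso e

theorem containsMelon_of_close {G : TensorGraph V} {a b : V} (h : G.IsTwoPoint a b)
    (hc : (G.close a b h).ContainsMelonAvoiding a) : G.ContainsMelon := by
  have hab : (G.close a b h).line a = b := by simp [close]
  refine (hc.map (H := G) (g := id) Function.injective_id (fun _ _ => rfl) (fun v h1 h2 => ?_) a
    fun v h1 _ => h1).containsMelon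
  rw [hab] at h2
  simp [close, h1, h2]

/-! ### Excision of a two-point subgraph -/

section Excision

variable {G : TensorGraph V} {M N : TensorGraph W} {a b : W} {f : W → V}

/-- With its legs joined, the image of `f` is closed under all colours, so by connectedness it is
the whole graph. -/
theorem nonempty_iso_of_closed [Finite V] (hG : G.IsExtremal)
    (hf : Function.Injective f) (hfe : ∀ ℓ w, f (M.edge ℓ w) = G.edge ℓ (f w))
    (hfl : ∀ w, M.line w ≠ w → f (M.line w) = G.line (f w)) (hM : M.IsTwoPoint a b)
    (he : N.edge = M.edge) (hab : N.line a = b)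
    (hl : ∀ w, w ≠ a → w ≠ b → N.line w = M.line w) (hline : G.line (f a) = f b) :
    Nonempty (G.Iso N) := by
  classical
  have hfl' : ∀ w, f (N.line w) = G.line (f w) := by
    intro w
    by_cases h1 : w = a
    · rw [h1, hab, hline]
    by_cases h2 : w = b
    · rw [h2, ← hab, N.line_line, hab, ← hline, G.line_line]
    · rw [hl w h1 h2]
      exact hfl w fun h => ((hM.2 w).1 h).elim h1 h2
  have hc : ∀ c w, f (N.col c w) = G.col c (f w) := by
    intro c w
    cases c with
    | none => exact hfl' w
    | some ℓ => simp only [col, he, hfe]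
  have : Nonempty V := ⟨f a⟩
  have hone := (orbitCount_eq_one_iff _).1 hG.orbits_univ
    (fun v => if v ∈ Set.range f then (1 : ℚ) else 0) (by
      rintro _ ⟨c, -, rfl⟩ v
      have : G.col c v ∈ Set.range f ↔ v ∈ Set.range f := by
        constructor
        · rintro ⟨w, hw⟩
          exact ⟨N.col c w, by rw [hc, hw, col_col]⟩
        · rintro ⟨w, rfl⟩
          exact ⟨_, hc c w⟩
      simp [this])
  have hs : Function.Surjective f := by
    intro v
    have := hone v (f a)
    by_contra hv
    simp [show v ∉ Set.range f from hv] at this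
  let e : N.Iso G :=
    { toEquiv := Equiv.ofBijective f ⟨hf, hs⟩
      map_edge := fun ℓ w => hc (some ℓ) w
      map_line := hfl' }
  exact ⟨e.symm⟩

/-- If an extremal graph contains a two-point graph, it arises by insertion from an extremal
graph. -/
theorem exists_iso_insertAt [Finite V] (hG : G.IsExtremal)
    (hf : Function.Injective f) (hfe : ∀ ℓ w, f (M.edge ℓ w) = G.edge ℓ (f w))
    (hfl : ∀ w, M.line w ≠ w → f (M.line w) = G.line (f w)) (hM : M.IsTwoPoint a b)
    (hline : G.line (f a) ≠ f b) :
    ∃ (S : Set V) (G' : TensorGraph S) (x : S) (hx : G'.line x ≠ x), S ≠ Set.univ ∧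
      G'.IsExtremal ∧ Nonempty (G.Iso (G'.insertAt x hx M a b hM)) := by
  classical
  have hs := G.switch_isSwitch hG.vacuum (f a) (f b) (hf.ne hM.1) hline.symm
  set G₁ := G.switch hG.vacuum (f a) (f b) (hf.ne hM.1) hline.symm
  have hr : ∀ w, w ≠ a → w ≠ b → G.line (f w) ∈ Set.range f := fun w h1 h2 =>
    ⟨M.line w, hfl w fun h => ((hM.2 w).1 h).elim h1 h2⟩
  have hna : G.line (f a) ∉ Set.range f := by
    rintro ⟨w, hw⟩
    have h1 : w ≠ a := by rintro rfl; exact hG.vacuum _ hw.symm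
    have h2 : w ≠ b := by rintro rfl; exact hline hw.symm
    have h3 : M.line w ≠ w := fun h => ((hM.2 w).1 h).elim h1 h2
    have h4 := hfl w h3
    rw [hw, G.line_line] at h4
    have h5 : M.line a = a := (hM.2 a).2 (Or.inl rfl)
    have h6 := hf h4
    exact h1 (by rw [← M.line_line w, h6, h5])
  have hnb : G.line (f b) ∉ Set.range f := by
    rintro ⟨w, hw⟩
    have h1 : w ≠ b := by rintro rfl; exact hG.vacuum _ hw.symm
    have h2 : w ≠ a := by rintro rfl; exact hline (by rw [hw, G.line_line])
    have h3 : M.line w ≠ w := fun h => ((hM.2 w).1 h).elim h2 h1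
    have h4 := hfl w h3
    rw [hw, G.line_line] at h4
    have h5 : M.line b = b := (hM.2 b).2 (Or.inr rfl)
    have h6 := hf h4
    exact h1 (by rw [← M.line_line w, h6, h5])
  -- After the switch the copy of `M` is closed off, and the complement is the graph into which `M`
  -- was inserted.
  have hS : ∀ c, ∀ v ∈ Set.range f, G₁.col c v ∈ Set.range f := by
    rintro c _ ⟨w, rfl⟩
    cases c with
    | some ℓ => exact ⟨M.edge ℓ w, hfe ℓ w⟩
    | none =>
      change G₁.line (f w) ∈ Set.range f
      by_cases h1 : w = a
      · rw [h1, hs.line_left]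
        exact ⟨b, rfl⟩
      by_cases h2 : w = b
      · rw [h2, hs.line_left']
        exact ⟨a, rfl⟩
      rw [hs.line_eq _ (hf.ne h1) (hf.ne h2) (fun h => hna ⟨w, h⟩) (fun h => hnb ⟨w, h⟩)]
      exact hr w h1 h2
  have hext := hs.restrict_isExtremal hG hS ⟨a, rfl⟩ hna
  refine ⟨(Set.range f)ᶜ, G₁.restrict _ (col_mem_compl hS), ⟨G.line (f a), hna⟩,
    hext.vacuum _, ?_, hext, ?_⟩
  · exact (Set.ne_univ_iff_exists_notMem _).2 ⟨f a, fun h => h ⟨a, rfl⟩⟩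
  have hl1 : (G₁.restrict _ (col_mem_compl hS)).line ⟨G.line (f a), hna⟩ =
      ⟨G.line (f b), hnb⟩ := Subtype.ext hs.line_right
  let e : ((G₁.restrict _ (col_mem_compl hS)).insertAt ⟨G.line (f a), hna⟩
      (hext.vacuum _) M a b hM).Iso G :=
    { toEquiv := Equiv.ofBijective (Sum.elim Subtype.val f) (by
        constructor
        · rintro (⟨v, hv⟩ | w) (⟨v', hv'⟩ | w') h
          · exact congrArg Sum.inl (Subtype.ext h)
          · exact absurd ⟨w', h.symm⟩ hv
          · exact absurd ⟨w, h⟩ hv'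
          · exact congrArg Sum.inr (hf h)
        · intro v
          by_cases hv : v ∈ Set.range f
          · obtain ⟨w, rfl⟩ := hv
            exact ⟨Sum.inr w, rfl⟩
          · exact ⟨Sum.inl ⟨v, hv⟩, rfl⟩)
      map_edge := by
        rintro ℓ (v | w)
        · rfl
        · exact hfe ℓ w
      map_line := by
        rintro (⟨v, hv⟩ | w)
        · change Sum.elim Subtype.val f _ = G.line v
          simp only [insertAt, hl1, Sum.elim_inl, Subtype.mk.injEq]
          by_cases h1 : v = G.line (f a)
          · simp [h1, G.line_line]
          by_cases h2 : v = G.line (f b)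
          · have : G.line (f b) ≠ G.line (f a) := by rwa [h2] at h1
            simp [h2, G.line_line, this]
          · simp only [h1, h2, if_false, Sum.elim_inl]
            exact hs.line_eq v (fun h => hv ⟨a, h.symm⟩) (fun h => hv ⟨b, h.symm⟩) h1 h2
        · change Sum.elim Subtype.val f _ = G.line (f w)
          simp only [insertAt, hl1, Sum.elim_inr]
          by_cases h1 : w = a
          · simp [h1]
          by_cases h2 : w = b
          · have : b ≠ a := by rwa [h2] at h1
            simp [h2, this]
          · simp only [h1, h2, if_false, Sum.elim_inr]
            exact hfl w fun h => ((hM.2 w).1 h).elim h1 h2 }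
  exact ⟨e.symm⟩

end Excision

/-- An extremal graph which contains an elementary melon is melonic if all smaller extremal graphs
are. -/
theorem isMelonic_of_containsMelon [Finite V] {G : TensorGraph V} (hG : G.IsExtremal)
    (hm : G.ContainsMelon)
    (ih : ∀ (S : Set V) (G' : TensorGraph S), S ≠ Set.univ → G'.IsExtremal → G'.IsMelonic) :
    G.IsMelonic := by
  rcases hm with ⟨f, hf, hfe, hfl⟩ | ⟨ℓ, f, hf, hfe, hfl⟩
  · by_cases hline : G.line (f (false, false, false)) = f (true, false, false)
    · exact .baseI G (nonempty_iso_of_closed hG hf hfe hfl melonI_isTwoPoint rfl rfl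
        baseI_line_eq hline)
    · obtain ⟨S, G', x, hx, hS, hG', e⟩ :=
        exists_iso_insertAt hG hf hfe hfl melonI_isTwoPoint hline
      exact .insertI G' G x hx (ih S G' hS hG') e
  · by_cases hline : G.line (f (false, false)) = f (false, true)
    · exact .baseII G ℓ (nonempty_iso_of_closed hG hf hfe hfl (melonII_isTwoPoint ℓ) rfl rfl
        (baseII_line_eq ℓ) hline)
    · obtain ⟨S, G', x, hx, hS, hG', e⟩ :=
        exists_iso_insertAt hG hf hfe hfl (melonII_isTwoPoint ℓ) hline
      exact .insertII G' G x hx ℓ (ih S G' hS hG') e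

end TensorGraph

/-! ### Counting faces by their length -/

/-- If no cycle of the involutions `l` and `e` has length at most four, and if the cycles have
lengths divisible by four because of the sign functions `ε` and `δ`, then all have length at least
eight. -/
theorem eight_mul_orbitCount_le {V : Type u} [Finite V] {l e : V → V} (hl : ∀ x, l (l x) = x)
    (he : ∀ x, e (e x) = x) {ε δ : V → ℚ} (hε : ∀ x, ε x ≠ 0) (hδ : ∀ x, δ x ≠ 0)
    (hεl : ∀ x, ε (l x) = -ε x) (hεe : ∀ x, ε (e x) = -ε x) (hδl : ∀ x, δ (l x) = -δ x)
    (hδe : ∀ x, δ (e x) = δ x) (h : ∀ x, l (e (l (e x))) ≠ x) :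
    8 * orbitCount {l, e} ≤ Nat.card V := by
  let r : V → V → Prop := fun p q => ∃ f ∈ ({l, e} : Set (V → V)), q = f p
  let E : Bool → V → V := fun a x => cond a (e x) x
  let T : Bool → V → V := fun a x => cond a (l (e x)) x
  let D : Bool → V → V := fun a x => cond a (l (e (l (e x)))) x
  have hel : ∀ x, Quot.mk r (l x) = Quot.mk r x := fun x =>
    (Quot.sound ⟨l, by simp, rfl⟩ : Quot.mk r x = Quot.mk r (l x)).symm
  have hee : ∀ x, Quot.mk r (e x) = Quot.mk r x := fun x =>
    (Quot.sound ⟨e, by simp, rfl⟩ : Quot.mk r x = Quot.mk r (e x)).symm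
  -- Eight nodes on each cycle: the sign of `ε` detects the use of `E`, the sign of `δ` that of `T`,
  -- and `h` separates the two values of `D`.
  let g : Quot r × Bool × Bool × Bool → V := fun z => E z.2.1 (T z.2.2.1 (D z.2.2.2 z.1.out))
  have hg : Function.Injective g := by
    rintro ⟨x, a, b, d⟩ ⟨x', a', b', d'⟩ hxx
    have hmk : ∀ x a b d, Quot.mk r (g (x, a, b, d)) = x := by
      intro x a b d
      rw [← Quot.out_eq x]
      cases a <;> cases b <;> cases d <;> simp [g, E, T, D, hel, hee]
    have hx : x = x' := by rw [← hmk x a b d, hxx, hmk]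
    subst hx
    have hεg : ∀ a b d, ε (g (x, a, b, d)) = cond a (-1) 1 * ε x.out := by
      intro a b d
      cases a <;> cases b <;> cases d <;> simp [g, E, T, D, hεl, hεe]
    have hδg : ∀ a b d, δ (g (x, a, b, d)) = cond b (-1) 1 * δ x.out := by
      intro a b d
      cases a <;> cases b <;> cases d <;> simp [g, E, T, D, hδl, hδe]
    have ha : a = a' := by
      have h1 := hεg a b d
      rw [hxx, hεg] at h1
      have h2 := mul_right_cancel₀ (hε _) h1
      revert h2
      cases a <;> cases a' <;> norm_num
    have hb : b = b' := by
      have h1 := hδg a b d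
      rw [hxx, hδg] at h1
      have h2 := mul_right_cancel₀ (hδ _) h1
      revert h2
      cases b <;> cases b' <;> norm_num
    subst ha hb
    have hE : Function.Injective (E a) := by
      cases a
      · exact Function.injective_id
      · exact Function.Involutive.injective he
    have hT : Function.Injective (T b) := by
      cases b
      · exact Function.injective_id
      · exact (Function.Involutive.injective hl).comp (Function.Involutive.injective he)
    have hD : D d x.out = D d' x.out := hT (hE hxx)
    have hd : d = d' := by
      cases d <;> cases d'
      · rfl
      · exact absurd hD.symm (h _)
      · exact absurd hD (h _)
      · rfl
    rw [hd]
  have hcard := Nat.card_le_card_of_injective g hg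
  have h8 : Nat.card (Bool × Bool × Bool) = 8 := by simp
  rw [Nat.card_prod, card_quot_eq_orbitCount {l, e} r fun _ _ => Iff.rfl, h8] at hcard
  omega

/-! ### Finding a melon: strands and pillows -/

namespace TensorGraph

variable {V : Type u}

/-- If two strands of different colours run from the line at `p` to the line at `q` through a part
`Z` of the graph, then the two lines form a cut of the graph, on the other side of which there is an
elementary melon. -/
theorem containsMelon_of_strands [Finite V] {G : TensorGraph V} (hG : G.IsExtremal)
    (ih : ∀ (S : Set V) (G' : TensorGraph S), S ≠ Set.univ → G'.IsExtremal → G'.IsMelonic)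
    {p q : V} (hpq : p ≠ q) (hq : q ≠ G.line p) (c : Fin 3)
    (hZ : ∀ ℓ, ℓ ≠ c → ∃ Z : Set V, p ∈ Z ∧ q ∈ Z ∧ G.line p ∉ Z ∧ G.line q ∉ Z ∧
      (∀ v ∈ Z, G.edge ℓ v ∈ Z) ∧ ∀ v ∈ Z, v ≠ p → v ≠ q → G.line v ∈ Z) :
    G.ContainsMelon := by
  have hs := G.switch_isSwitch hG.vacuum p q hpq hq
  set G₁ := G.switch hG.vacuum p q hpq hq
  have hface : ∀ ℓ, ℓ ≠ c → G₁.orbits {none, some ℓ} = G.orbits {none, some ℓ} + 1 := by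
    intro ℓ hℓ
    obtain ⟨Z, h1, h2, h3, h4, h5, h6⟩ := hZ ℓ hℓ
    refine hs.orbits_eq hG.vacuum (Z := Z) (by simp) (ℓ := ℓ) (by simp) ?_ h1 h3
    rintro _ (rfl | rfl) v hv
    · change G₁.line v ∈ Z
      by_cases hvp : v = p
      · rwa [hvp, hs.line_left]
      by_cases hvq : v = q
      · rwa [hvq, hs.line_left']
      rw [hs.line_eq v hvp hvq (fun h => h3 (h ▸ hv)) (fun h => h4 (h ▸ hv))]
      exact h6 v hv hvp hvq
    · exact h5 v hv
  -- Two colours gain a face each, while colour `c` loses at most one.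
  have hsum : G.faceSum + 1 ≤ G₁.faceSum := by
    have h1 := hs.orbits_le {none, some c}
    rw [faceSum, faceSum]
    have hc : c = 0 ∨ c = 1 ∨ c = 2 := by fin_cases c <;> simp
    rcases hc with rfl | rfl | rfl
    · have h2 := hface 1 (by decide)
      have h3 := hface 2 (by decide)
      omega
    · have h2 := hface 0 (by decide)
      have h3 := hface 2 (by decide)
      omega
    · have h2 := hface 0 (by decide)
      have h3 := hface 1 (by decide)
      omega
  have hK : G₁.orbits Set.univ ≠ 1 := by
    have h1 := two_mul_faceSum_le (hs.isVacuum hG.vacuum) (hs.isQuartic hG.quartic)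
    have h2 := hG.two_mul_faceSum
    rw [hs.pairSum_eq] at h1
    omega
  have : Nonempty V := ⟨p⟩
  have hK' := (orbitCount_eq_one_iff (G₁.col '' Set.univ)).not.1 hK
  push Not at hK'
  obtain ⟨φ, hφ, y, z, hyz⟩ := hK'
  -- Otherwise `φ` would be invariant on the connected graph `G`, hence constant. So its level set
  -- at `p` is one side of the cut.
  have hφp : φ (G.line p) ≠ φ p := by
    intro h
    exact hyz ((orbitCount_eq_one_iff _).1 hG.orbits_univ φ
      (hs.mem_of_mem' hφ fun _ => h.symm) y z)
  have hS : ∀ c, ∀ v ∈ {v | φ v = φ p}, G₁.col c v ∈ {v | φ v = φ p} :=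
    fun c v hv => (hφ _ ⟨c, trivial, rfl⟩ v).trans hv
  have hext := hs.restrict_isExtremal hG hS rfl hφp
  have hmel := ih _ _ ((Set.ne_univ_iff_exists_notMem {v | φ v = φ p}ᶜ).2
    ⟨p, fun h => h (rfl : φ p = φ p)⟩) hext
  have hcon := hmel.containsMelonAvoiding ⟨G.line p, hφp⟩
  refine (hcon.map (H := G) Subtype.val_injective (fun _ _ => rfl) ?_ (G.line p) ?_).containsMelon
  · rintro ⟨v, hv⟩ h1 h2
    have h1' : v ≠ G.line p := fun h => h1 (Subtype.ext h)
    have h2' : v ≠ G.line q := fun h => h2 (Subtype.ext (h.trans hs.line_right.symm))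
    have hvp : v ≠ p := by
      rintro rfl
      exact hv rfl
    have hvq : v ≠ q := by
      rintro rfl
      refine hv ?_
      have := hφ _ ⟨none, trivial, rfl⟩ p
      change φ (G₁.line p) = φ p at this
      rwa [hs.line_left] at this
    exact hs.line_eq v hvp hvq h1' h2'
  · exact fun v hv _ h => hv (Subtype.ext h)

/-- A double edge is itself a strand in each of its two colours; it either carries a parallel line,
which gives a melon of type II, or yields a cut. -/
theorem containsMelon_of_pillow [Finite V] {G : TensorGraph V} (hG : G.IsExtremal)
    (ih : ∀ (S : Set V) (G' : TensorGraph S), S ≠ Set.univ → G'.IsExtremal → G'.IsMelonic)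
    {ℓ : Fin 3} {x : V} (hx : G.KindAt (.pillow ℓ) x) : G.ContainsMelon := by
  obtain ⟨f, hf, -, hfe⟩ := hx
  by_cases hline : G.line (f (false, false)) = f (false, true)
  -- The translation swaps the double edges, as the internal line of `melonII` is on the one with
  -- first coordinate `true`.
  · refine Or.inr ⟨ℓ, f ∘ BubbleKind.translate (true, false),
      hf.comp (BubbleKind.translate_injective _), fun i w => ?_, fun w hw => ?_⟩
    · rw [Function.comp_apply, Function.comp_apply, ← hfe, BubbleKind.edge_translate]
      rfl
    · have h1 := (melonII_line_ne_iff ℓ w).1 hw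
      obtain ⟨s, t⟩ := w
      obtain rfl : s = true := h1
      cases t
      · exact hline.symm
      · change f (false, false) = G.line (f (false, true))
        rw [← hline, G.line_line]
  · have hne : f (false, false) ≠ f (false, true) := hf.ne (by simp)
    refine containsMelon_of_strands hG ih hne (Ne.symm hline) ℓ fun i hi =>
      ⟨{f (false, false), f (false, true)}, by simp, by simp, ?_, ?_, ?_, ?_⟩
    · rintro (h | h)
      · exact hG.vacuum _ h
      · exact hline h
    · rintro (h | h)
      · exact hline (by rw [← h, G.line_line])
      · exact hG.vacuum _ h
    · rintro _ (rfl | rfl) <;> rw [← hfe] <;> simp [BubbleKind.edge, hi]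
    · rintro _ (rfl | rfl) h1 h2
      · exact absurd rfl h1
      · exact absurd rfl h2

/-! ### Extremal graphs made of tetrahedra -/

section Tetrahedra

variable {G : TensorGraph V}

theorem edge_edge_of_tetra (hT : ∀ x, G.KindAt .tetra x) {i j k : Fin 3} (hij : i ≠ j)
    (hik : i ≠ k) (hjk : j ≠ k) (x : V) : G.edge i (G.edge j x) = G.edge k x := by
  obtain ⟨f, -, rfl, hf⟩ := hT x
  rw [← hf, ← hf, ← hf]
  congr 1
  revert i j k
  decide

/-- In a tetrahedron the composite of two colours is the third, so two edge colours connect as much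
as three. -/
theorem orbits_eq_of_tetra [Finite V] (hT : ∀ x, G.KindAt .tetra x) {A B : Set (Option (Fin 3))}
    (hAB : A ⊆ B) (h0 : none ∈ B → none ∈ A) {i j : Fin 3} (hij : i ≠ j) (hi : some i ∈ A)
    (hj : some j ∈ A) : G.orbits A = G.orbits B := by
  refine le_antisymm (Submodule.finrank_mono ?_) (orbitCount_anti (Set.image_mono hAB))
  rintro φ hφ _ ⟨c, hc, rfl⟩ x
  cases c with
  | none => exact hφ _ ⟨none, h0 hc, rfl⟩ x
  | some k =>
    have hi' : ∀ x, φ (G.edge i x) = φ x := hφ _ ⟨_, hi, rfl⟩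
    have hj' : ∀ x, φ (G.edge j x) = φ x := hφ _ ⟨_, hj, rfl⟩
    change φ (G.edge k x) = φ x
    by_cases hik : i = k
    · rw [← hik, hi']
    by_cases hjk : j = k
    · rw [← hjk, hj']
    rw [← edge_edge_of_tetra hT hij hik hjk, hi', hj']

/-- The strand is the colour-`ℓ` edge at `s`, the line from `s` to `t`, and the colour-`ℓ` edge at
`t`; the signs of `δ` exclude lines within one bubble. -/
theorem strand_of_line {δ : V → ℚ} (hG : G.IsExtremal) (hδ : ∀ x, δ x ≠ 0)
    (hδl : ∀ x, δ (G.line x) = -δ x) (hδe : ∀ ℓ x, δ (G.edge ℓ x) = δ x) (ℓ : Fin 3) {s t : V}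
    (hst : G.line s = t) (hpq : G.edge ℓ t ≠ G.line (G.edge ℓ s)) :
    ∃ Z : Set V, G.edge ℓ s ∈ Z ∧ G.edge ℓ t ∈ Z ∧ G.line (G.edge ℓ s) ∉ Z ∧
      G.line (G.edge ℓ t) ∉ Z ∧ (∀ v ∈ Z, G.edge ℓ v ∈ Z) ∧
      ∀ v ∈ Z, v ≠ G.edge ℓ s → v ≠ G.edge ℓ t → G.line v ∈ Z := by
  have hts : G.line t = s := by rw [← hst, G.line_line]
  have hne : ∀ x y, δ x = δ y → G.line x ≠ y := by
    rintro x _ hxy rfl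
    rw [hδl] at hxy
    exact hδ x (by linarith)
  refine ⟨{G.edge ℓ s, s, t, G.edge ℓ t}, by simp, by simp, ?_, ?_, ?_, ?_⟩
  · rintro (h | h | h | h)
    · exact hG.vacuum _ h
    · exact hne _ _ (hδe ℓ s) h
    · refine G.edge_ne ℓ s ?_
      rw [← G.line_line (G.edge ℓ s), h, hts]
    · exact hpq h.symm
  · rintro (h | h | h | h)
    · exact hpq (by rw [← h, G.line_line])
    · refine G.edge_ne ℓ t ?_
      rw [← G.line_line (G.edge ℓ t), h, hst]
    · exact hne _ _ (hδe ℓ t) h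
    · exact hG.vacuum _ h
  · rintro _ (rfl | rfl | rfl | rfl) <;> simp [G.edge_edge]
  · rintro _ (rfl | rfl | rfl | rfl) h1 h2
    · exact absurd rfl h1
    · simp [hst]
    · simp [hts]
    · exact absurd rfl h2

variable [Finite V]

theorem orbits_add_le_of_tetra {i j : Fin 3} (hij : i ≠ j) (hG : G.IsExtremal)
    (hT : ∀ x, G.KindAt .tetra x) :
    G.orbits {none, some i} + G.orbits {none, some j} ≤ G.orbits {some 0, some 1, some 2} + 1 +
      finrank ℚ (antiFun {G.line, G.edge i, G.edge j}) := by
  have hcard := card_eq_four_mul hG.quartic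
  have h1 := orbitCount_euler (α := G.line) (β := G.edge i) (γ := G.edge j) G.line_line
    (G.edge_edge i) (G.edge_edge j) hG.vacuum (G.edge_ne i) (G.edge_ne j)
  have h2 : G.orbits {some i, some j} = G.orbits {some 0, some 1, some 2} := by
    refine orbits_eq_of_tetra hT ?_ (by simp) hij (by simp) (by simp)
    rintro _ (rfl | rfl)
    · fin_cases i <;> simp
    · fin_cases j <;> simp
  have h3 : G.orbits {none, some i, some j} = 1 := by
    rw [← hG.orbits_univ]
    exact orbits_eq_of_tetra hT (Set.subset_univ _) (by simp) hij (by simp) (by simp)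
  simp only [orbits, Set.image_insert_eq, Set.image_singleton, col] at *
  omega

theorem finrank_antiFun_le_one_of_tetra {i j : Fin 3} (hij : i ≠ j) (hG : G.IsExtremal)
    (hT : ∀ x, G.KindAt .tetra x) :
    finrank ℚ (antiFun {G.line, G.edge i, G.edge j}) ≤ 1 := by
  have h3 : G.orbits {none, some i, some j} = 1 := by
    rw [← hG.orbits_univ]
    exact orbits_eq_of_tetra hT (Set.subset_univ _) (by simp) hij (by simp) (by simp)
  rw [← h3]
  have := finrank_antiFun_le {G.line, G.edge i, G.edge j}
  simpa only [orbits, Set.image_insert_eq, Set.image_singleton, col] using this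

theorem pairSum_of_tetra (hT : ∀ x, G.KindAt .tetra x) :
    G.pairSum = 3 * G.orbits {some 0, some 1, some 2} := by
  rw [pairSum, orbits_eq_of_tetra hT (A := {some 0, some 1}) (B := {some 0, some 1, some 2})
      (i := 0) (j := 1), orbits_eq_of_tetra hT (A := {some 0, some 2})
      (B := {some 0, some 1, some 2}) (i := 0) (j := 2), orbits_eq_of_tetra hT
      (A := {some 1, some 2}) (B := {some 0, some 1, some 2}) (i := 1) (j := 2)]
  · ring
  all_goals simp

/-- Summing the three pairwise Euler bounds gives exactly the extremal number of faces, so each is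
attained, with its surface orientable. -/
theorem two_mul_orbits_face_of_tetra (hG : G.IsExtremal) (hT : ∀ x, G.KindAt .tetra x) :
    2 * G.orbits {none, some 0} = G.orbits {some 0, some 1, some 2} + 2 ∧
      0 < finrank ℚ (antiFun {G.line, G.edge 0, G.edge 1}) ∧
      0 < finrank ℚ (antiFun {G.line, G.edge 0, G.edge 2}) ∧
      0 < finrank ℚ (antiFun {G.line, G.edge 1, G.edge 2}) := by
  have h01 : (0 : Fin 3) ≠ 1 := by decide
  have h02 : (0 : Fin 3) ≠ 2 := by decide
  have h12 : (1 : Fin 3) ≠ 2 := by decide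
  have a1 := orbits_add_le_of_tetra h01 hG hT
  have a2 := orbits_add_le_of_tetra h02 hG hT
  have a3 := orbits_add_le_of_tetra h12 hG hT
  have b1 := finrank_antiFun_le_one_of_tetra h01 hG hT
  have b2 := finrank_antiFun_le_one_of_tetra h02 hG hT
  have b3 := finrank_antiFun_le_one_of_tetra h12 hG hT
  have hF := hG.two_mul_faceSum
  rw [pairSum_of_tetra hT, faceSum] at hF
  omega

theorem exists_antiFun_ne_zero {i j : Fin 3} (hij : i ≠ j) (hG : G.IsExtremal)
    (hT : ∀ x, G.KindAt .tetra x) (h : 0 < finrank ℚ (antiFun {G.line, G.edge i, G.edge j})) :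
    ∃ ψ : V → ℚ, (∀ x, ψ x ≠ 0) ∧ (∀ x, ψ (G.line x) = -ψ x) ∧ (∀ x, ψ (G.edge i x) = -ψ x) ∧
      ∀ x, ψ (G.edge j x) = -ψ x := by
  have : Nontrivial (antiFun {G.line, G.edge i, G.edge j}) := Module.nontrivial_of_finrank_pos h
  obtain ⟨⟨ψ, hψ⟩, hne⟩ := exists_ne (0 : antiFun {G.line, G.edge i, G.edge j})
  obtain ⟨y, hy⟩ : ∃ y, ψ y ≠ 0 := by
    by_contra! h
    exact hne (Subtype.ext (funext h))
  have hl : ∀ x, ψ (G.line x) = -ψ x := hψ _ (by simp)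
  have hi : ∀ x, ψ (G.edge i x) = -ψ x := hψ _ (by simp)
  have hj : ∀ x, ψ (G.edge j x) = -ψ x := hψ _ (by simp)
  refine ⟨ψ, fun x hx => hy ?_, hl, hi, hj⟩
  have h3 : G.orbits {none, some i, some j} = 1 := by
    rw [← hG.orbits_univ]
    exact orbits_eq_of_tetra hT (Set.subset_univ _) (by simp) hij (by simp) (by simp)
  have : Nonempty V := ⟨x⟩
  -- The square is invariant, hence constant on the connected surface, so a single zero would force
  -- `ψ = 0`.
  have h4 := (orbitCount_eq_one_iff _).1 h3 (fun v => ψ v ^ 2) (by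
    rintro _ ⟨c, (rfl | rfl | rfl), rfl⟩ v
    · simp [col, hl]
    · simp [col, hi]
    · simp [col, hj]) y x
  simp only [hx] at h4
  exact pow_eq_zero_iff two_ne_zero |>.1 (h4.trans (by norm_num))

/-- In an extremal graph of tetrahedra the bubbles are two-coloured such that all lines join bubbles
of different colours, and there is a face with two lines. -/
theorem exists_short_face (hG : G.IsExtremal) (hT : ∀ x, G.KindAt .tetra x) :
    (∃ δ : V → ℚ, (∀ x, δ x ≠ 0) ∧ (∀ x, δ (G.line x) = -δ x) ∧ ∀ ℓ x, δ (G.edge ℓ x) = δ x) ∧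
      ∃ x, G.line (G.edge 0 (G.line (G.edge 0 x))) = x := by
  obtain ⟨hF, h01, h02, h12⟩ := two_mul_orbits_face_of_tetra hG hT
  obtain ⟨ψ, hψ, hψl, hψ0, hψ1⟩ := exists_antiFun_ne_zero (by decide) hG hT h01
  obtain ⟨χ, hχ, hχl, hχ0, hχ2⟩ := exists_antiFun_ne_zero (by decide) hG hT h02
  obtain ⟨ξ, hξ, hξl, hξ1, hξ2⟩ := exists_antiFun_ne_zero (by decide) hG hT h12
  have hψ2 : ∀ x, ψ (G.edge 2 x) = ψ x := fun x => by
    rw [← edge_edge_of_tetra hT (i := 0) (j := 1) (by decide) (by decide) (by decide), hψ0, hψ1,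
      neg_neg]
  have hχ1 : ∀ x, χ (G.edge 1 x) = χ x := fun x => by
    rw [← edge_edge_of_tetra hT (i := 0) (j := 2) (by decide) (by decide) (by decide), hχ0, hχ2,
      neg_neg]
  have hξ0 : ∀ x, ξ (G.edge 0 x) = ξ x := fun x => by
    rw [← edge_edge_of_tetra hT (i := 1) (j := 2) (by decide) (by decide) (by decide), hξ1, hξ2,
      neg_neg]
  -- Each edge colour flips exactly two of the three signs, while a line flips all three.
  have hδ : ∀ x, ψ x * χ x * ξ x ≠ 0 := fun x => mul_ne_zero (mul_ne_zero (hψ x) (hχ x)) (hξ x)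
  have hδl : ∀ x, ψ (G.line x) * χ (G.line x) * ξ (G.line x) = -(ψ x * χ x * ξ x) := fun x => by
    rw [hψl, hχl, hξl]
    ring
  have hδe : ∀ ℓ x, ψ (G.edge ℓ x) * χ (G.edge ℓ x) * ξ (G.edge ℓ x) = ψ x * χ x * ξ x := by
    intro ℓ x
    have hℓ : ℓ = 0 ∨ ℓ = 1 ∨ ℓ = 2 := by fin_cases ℓ <;> simp
    rcases hℓ with rfl | rfl | rfl
    · rw [hψ0, hχ0, hξ0]
      ring
    · rw [hψ1, hχ1, hξ1]
      ring
    · rw [hψ2, hχ2, hξ2]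
      ring
  refine ⟨⟨fun x => ψ x * χ x * ξ x, hδ, hδl, hδe⟩, ?_⟩
  by_contra! h
  -- With B bubbles there are 4B nodes and B/2 + 1 faces of this colour, too many for eight nodes
  -- each.
  have h8 := eight_mul_orbitCount_le G.line_line (G.edge_edge 0) hψ hδ hψl hψ0 hδl (hδe 0) h
  have hcard := card_eq_four_mul hG.quartic
  simp only [orbits, Set.image_insert_eq, Set.image_singleton, col] at *
  omega

theorem containsMelon_of_tetra (hG : G.IsExtremal)
    (ih : ∀ (S : Set V) (G' : TensorGraph S), S ≠ Set.univ → G'.IsExtremal → G'.IsMelonic)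
    (hT : ∀ x, G.KindAt .tetra x) : G.ContainsMelon := by
  obtain ⟨⟨δ, hδ, hδl, hδe⟩, x, hx⟩ := exists_short_face hG hT
  have e12 : ∀ x, G.edge 1 (G.edge 2 x) = G.edge 0 x :=
    edge_edge_of_tetra hT (by decide) (by decide) (by decide)
  have e20 : ∀ x, G.edge 2 (G.edge 0 x) = G.edge 1 x :=
    edge_edge_of_tetra hT (by decide) (by decide) (by decide)
  have e02 : ∀ x, G.edge 0 (G.edge 2 x) = G.edge 1 x :=
    edge_edge_of_tetra hT (by decide) (by decide) (by decide)
  set y := G.edge 0 (G.line (G.edge 0 x)) with hy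
  have hxy : G.line x = y := by rw [← hx, G.line_line]
  have hxy0 : G.line (G.edge 0 x) = G.edge 0 y := by rw [hy, G.edge_edge]
  have hδy : δ y = -δ x := by rw [← hxy, hδl]
  by_cases hline : G.line (G.edge 1 x) = G.edge 1 y
  -- Three lines join the tetrahedra of `x` and `y`, so the legs sit at the remaining corners
  -- `G.edge 2 x` and `G.edge 2 y`.
  · obtain ⟨f, hf, hfx, hfe⟩ := hT (G.edge 2 x)
    obtain ⟨g, hg, hgy, hge⟩ := hT (G.edge 2 y)
    have hδf : ∀ k, δ (f k) = δ x := mem_of_corner hfe (s := {v | δ v = δ x})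
      (fun ℓ v hv => (hδe ℓ v).trans hv) (by rw [Set.mem_ofPred_eq, hfx, hδe])
    have hδg : ∀ k, δ (g k) = -δ x := mem_of_corner hge (s := {v | δ v = -δ x})
      (fun ℓ v hv => (hδe ℓ v).trans hv) (by rw [Set.mem_ofPred_eq, hgy, hδe, hδy])
    have hfg : ∀ k k', f k ≠ g k' := by
      intro k k' h
      have h1 := hδf k
      rw [h, hδg] at h1
      exact hδ x (by linarith)
    have hfgl : ∀ k, k ≠ (false, false) → G.line (f k) = g k := by
      have h0 : ∀ ℓ, f (BubbleKind.tetra.edge ℓ (false, false)) = G.edge ℓ (G.edge 2 x) :=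
        fun ℓ => by rw [hfe, hfx]
      have h0' : ∀ ℓ, g (BubbleKind.tetra.edge ℓ (false, false)) = G.edge ℓ (G.edge 2 y) :=
        fun ℓ => by rw [hge, hgy]
      have key : ∀ ℓ, G.line (f (BubbleKind.tetra.edge ℓ (false, false))) =
          g (BubbleKind.tetra.edge ℓ (false, false)) := by
        intro ℓ
        rw [h0, h0']
        have hℓ : ℓ = 0 ∨ ℓ = 1 ∨ ℓ = 2 := by fin_cases ℓ <;> simp
        rcases hℓ with rfl | rfl | rfl
        · rw [e02, e02, hline]
        · rw [e12, e12, hxy0]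
        · rw [G.edge_edge, G.edge_edge, hxy]
      rintro ⟨s, t⟩ hk
      cases s <;> cases t
      · exact absurd rfl hk
      · exact key 1
      · exact key 0
      · exact key 2
    refine Or.inl ⟨fun w => cond w.1 (g w.2) (f w.2), ?_, ?_, ?_⟩
    · rintro ⟨s, k⟩ ⟨s', k'⟩ h
      cases s <;> cases s'
      · exact congrArg (Prod.mk false) (hf h)
      · exact absurd h (hfg _ _)
      · exact absurd h.symm (hfg _ _)
      · exact congrArg (Prod.mk true) (hg h)
    · rintro ℓ ⟨s, k⟩
      cases s
      · exact hfe ℓ k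
      · exact hge ℓ k
    · rintro ⟨s, k⟩ hw
      have hk := (melonI_line_ne_iff _).1 hw
      have hl : melonI.line (s, k) = (!s, k) := by simpa [melonI] using hk
      rw [hl]
      cases s
      · exact (hfgl k hk).symm
      · change f k = G.line (g k)
        rw [← hfgl k hk, G.line_line]
  · have hne : G.edge 1 x ≠ G.edge 1 y := by
      intro h
      have h1 := congrArg δ h
      rw [hδe, hδe, hδy] at h1
      exact hδ x (by linarith)
    -- The two lines of the short face carry the strands: colour 1 passes through the line at `x`,
    -- colour 2 through the line at `G.edge 0 x`.
    refine containsMelon_of_strands hG ih hne (Ne.symm hline) 0 fun ℓ hℓ => ?_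
    have hℓ' : ℓ = 1 ∨ ℓ = 2 := by
      revert hℓ
      fin_cases ℓ <;> simp
    rcases hℓ' with rfl | rfl
    · exact strand_of_line hG hδ hδl hδe 1 hxy (Ne.symm hline)
    · have := strand_of_line hG hδ hδl hδe 2 hxy0
        (by rw [e20, e20]; exact Ne.symm hline)
      rwa [e20, e20] at this

end Tetrahedra

/-! ### Induction on the number of nodes, and conclusion -/

theorem IsExtremal.isMelonic [Finite V] {G : TensorGraph V} (hG : G.IsExtremal) :
    G.IsMelonic := by
  induction hn : Nat.card V using Nat.strong_induction_on generalizing V with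
  | _ n ih =>
    have ih' : ∀ (S : Set V) (G' : TensorGraph S), S ≠ Set.univ → G'.IsExtremal →
        G'.IsMelonic := by
      intro S G' hS hG'
      refine ih _ ?_ hG' rfl
      rw [← hn]
      obtain ⟨x, hx⟩ := (Set.ne_univ_iff_exists_notMem S).1 hS
      exact Finite.card_subtype_lt hx
    refine isMelonic_of_containsMelon hG ?_ ih'
    by_cases hT : ∀ x, G.KindAt .tetra x
    · exact containsMelon_of_tetra hG ih' hT
    · push Not at hT
      obtain ⟨x, hx⟩ := hT
      obtain ⟨b, hb⟩ := isQuartic_iff.1 hG.quartic x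
      cases b with
      | tetra => exact absurd hb hx
      | pillow ℓ => exact containsMelon_of_pillow hG ih' hb

end TensorGraph

/-- The vacuum leading order graphs of the quartic model are the vacuum melonic graphs, and every
two-point leading order graph contains an elementary melon of type I or of type II. -/
theorem mainTheorem2 {V : Type*} [Finite V] :
    (∀ G : TensorGraph V, G.IsLeadingOrder ↔ G.IsMelonic) ∧
    (∀ (G : TensorGraph V) (a b : V) (h : G.IsTwoPoint a b), (G.close a b h).IsLeadingOrder →
      G.Contains TensorGraph.melonI ∨ ∃ ℓ, G.Contains (TensorGraph.melonII ℓ)) := by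
  have main : ∀ G : TensorGraph V, G.IsLeadingOrder ↔ G.IsMelonic := fun G =>
    TensorGraph.isLeadingOrder_iff.trans ⟨fun h => h.isMelonic, fun h => h.isExtremal.2⟩
  exact ⟨main, fun G a b h hc => TensorGraph.containsMelon_of_close h
    (((main _).1 hc).containsMelonAvoiding a)⟩
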